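/- Let $\Gamma=(V,E)$ be a connected simple graph that is uniform, i.e. for some $\mu\in\mathbb N$ every vertex has at most $\mu$ neighbours. Regard $\Gamma$ as a geodesic metric space with its path metric $d_\Gamma$, each edge being isometric to $[0,1]$ (so the points of $\Gamma$ are the vertices and the interior points of the edges). With the Gromov product $(x|y)_o=\frac12\big(d_\Gamma(x,o)+d_\Gamma(y,o)-d_\Gamma(x,y)\big)$, assume that $\Gamma$ is Gromov hyperbolic: there is $\delta\ge 0$ such that $(x|y)_o\ge\min\{(x|z)_o,(z|y)_o\}-\delta$ for all points $o,x,y,z$ of $\Gamma$. Let $$h(\Gamma)=\inf_A\frac{|\partial A|}{|A|},\qquad \partial A=\{v\in V : d_\Gamma(v,A)=1\},$$ where $A$ ranges over all non-empty finite subsets of $V$. Then $h(\Gamma)>0$ if and only if the following three conditions hold: 1. $\Gamma$ is infinite (that is, $V$ is infinite); 2. $\Gamma$ has a pole: there are a point $v$ of $\Gamma$ and $M>0$ such that every point of $\Gamma$ lies in the $M$-neighbourhood of some geodesic ray emanating from $v$; 3. there is a visual metric $d$ on the boundary at infinity $\partial_\infty\Gamma$ such that $(\partial_\infty\Gamma,d)$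 is uniformly perfect. Here $\partial_\infty\Gamma$ is the set of sequences $(x_i)$ of points of $\Gamma$ with $\lim_{i,j\to\infty}(x_i|x_j)_o=\infty$, modulo the equivalence relation $(x_i)\sim(x_i')$ iff $\lim_{i\to\infty}(x_i|x_i')_o=\infty$ (these notions do not depend on $o$). For $\xi,\xi'\in\partial_\infty\Gamma$ put $(\xi|\xi')_o=\inf\liminf_{i\to\infty}(x_i|x_i')_o\in[0,\infty]$, the infimum being over all $(x_i)\in\xi$, $(x_i')\in\xi'$. A metric $d$ on $\partial_\infty\Gamma$ is visual if there are a point $o$ of $\Gamma$, $a>1$ and $c_1,c_2>0$ with $c_1a^{-(\xi|\xi')_o}\le d(\xi,\xi')\le c_2a^{-(\xi|\xi')_o}$ for all $\xi,\xi'\in\partial_\infty\Gamma$ (where $a^{-\infty}=0$). A metric space $(Y,d)$ is uniformly perfect if there are $S>1$ and $\varepsilon_0>0$ such that for every $x\in Y$ and every $0<\varepsilon\le\varepsilon_0$ there is $y\in Y$ with $\varepsilon/S<d(x,y)\le\varepsilon$. -/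

import Mathlib

open Filter Set
open scoped ENNReal NNReal

/-! ### Graphs -/

/-- A graph is uniform if the number of neighbours of its vertices is bounded. -/
def IsUniformGraph {V : Type*} (G : SimpleGraph V) : Prop :=
  ∃ μ : ℕ, ∀ v : V, (G.neighborSet v).encard ≤ μ

/-- The (outer) vertex boundary `{v | d(v, A) = 1}` of a set of vertices. -/
def vertexBoundary {V : Type*} (G : SimpleGraph V) (A : Set V) : Set V :=
  {v | (⨅ a ∈ A, G.edist v a) = 1}

/-- The combinatorial Cheeger isoperimetric constant `inf_A |∂A| / |A|`, the infimum being over all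
nonempty finite sets of vertices. -/
noncomputable def cheegerConstant {V : Type*} (G : SimpleGraph V) : ℝ≥0∞ :=
  ⨅ (A : Finset V) (_ : A.Nonempty),
    ((vertexBoundary G (A : Set V)).encard : ℝ≥0∞) / (A.card : ℝ≥0∞)

/-! ### The metric graph: every edge is a copy of `[0, 1]` -/

/-- A representative of a point of the metric graph of a connected graph `G`: either the point of
the edge joining `src` to `tgt` at distance `pos ∈ [0, 1]` from `src`, or (when `src = tgt` and
`pos = 0`) the vertex `src`. A point may have several representatives. -/
structure MetricGraphRep {V : Type*} (G : SimpleGraph V) (hG : G.Connected) where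
  src : V
  tgt : V
  pos : ℝ
  pos_nonneg : 0 ≤ pos
  pos_le_one : pos ≤ 1
  valid : G.Adj src tgt ∨ (src = tgt ∧ pos = 0)

namespace MetricGraphRep

variable {V : Type*} {G : SimpleGraph V} {hG : G.Connected}

/-- The two endpoints of the edge. -/
def vert (p : MetricGraphRep G hG) : Bool → V
  | false => p.src
  | true => p.tgt

/-- The length of the part of the edge from the point to each of the two endpoints. -/
def off (p : MetricGraphRep G hG) : Bool → ℝ
  | false => p.pos
  | true => 1 - p.pos

open Classical in
/-- The path distance: two points of one edge are joined along that edge, and a shortest path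
between points of different edges leaves the first edge through one of its endpoints and enters the
second one through one of its endpoints. -/
noncomputable def pathDist (p q : MetricGraphRep G hG) : ℝ :=
  if p.src = q.src ∧ p.tgt = q.tgt then |p.pos - q.pos|
  else if p.src = q.tgt ∧ p.tgt = q.src then |p.pos - (1 - q.pos)|
  else ⨅ ij : Bool × Bool,
    (p.off ij.1 + (G.dist (p.vert ij.1) (q.vert ij.2) : ℝ) + q.off ij.2)

theorem off_nonneg (p : MetricGraphRep G hG) (i : Bool) : 0 ≤ p.off i := by
  have h0 := p.pos_nonneg
  have h1 := p.pos_le_one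
  cases i <;> simp only [off] <;> linarith

theorem dist_vert_le (p : MetricGraphRep G hG) (i j : Bool) (h : i ≠ j) :
    (G.dist (p.vert i) (p.vert j) : ℝ) ≤ p.off i + p.off j := by
  have key : ∀ u v : V, (G.Adj u v ∨ u = v) → (G.dist u v : ℝ) ≤ 1 := by
    rintro u v (h | rfl)
    · rw [SimpleGraph.dist_eq_one_iff_adj.2 h]; simp
    · simp
  have hv : G.Adj p.src p.tgt ∨ p.src = p.tgt := p.valid.imp_right And.left
  cases i <;> cases j <;> simp only [vert, off] at * <;> try contradiction
  · linarith [key _ _ hv]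
  · linarith [key _ _ (hv.imp SimpleGraph.Adj.symm Eq.symm)]

theorem through_bddBelow (p q : MetricGraphRep G hG) :
    BddBelow (range fun ij : Bool × Bool =>
      (p.off ij.1 + (G.dist (p.vert ij.1) (q.vert ij.2) : ℝ) + q.off ij.2)) :=
  (finite_range _).bddBelow

theorem pathDist_cases (p q : MetricGraphRep G hG) :
    (p.src = q.src ∧ p.tgt = q.tgt ∧ p.pathDist q = |p.pos - q.pos|) ∨
    (p.src = q.tgt ∧ p.tgt = q.src ∧ p.pathDist q = |p.pos - (1 - q.pos)|) ∨
    ∃ i j, p.pathDist q = p.off i + (G.dist (p.vert i) (q.vert j) : ℝ) + q.off j := by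
  by_cases h1 : p.src = q.src ∧ p.tgt = q.tgt
  · exact Or.inl ⟨h1.1, h1.2, if_pos h1⟩
  by_cases h2 : p.src = q.tgt ∧ p.tgt = q.src
  · exact Or.inr (Or.inl ⟨h2.1, h2.2, by rw [pathDist, if_neg h1, if_pos h2]⟩)
  refine Or.inr (Or.inr ?_)
  obtain ⟨ij, hij⟩ := exists_eq_ciInf_of_finite (f := fun ij : Bool × Bool =>
      (p.off ij.1 + (G.dist (p.vert ij.1) (q.vert ij.2) : ℝ) + q.off ij.2))
  exact ⟨ij.1, ij.2, by rw [pathDist, if_neg h1, if_neg h2]; exact hij.symm⟩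

theorem pathDist_nonneg (p q : MetricGraphRep G hG) : 0 ≤ p.pathDist q := by
  rcases pathDist_cases p q with ⟨-, -, h⟩ | ⟨-, -, h⟩ | ⟨i, j, h⟩
  · rw [h]; exact abs_nonneg _
  · rw [h]; exact abs_nonneg _
  · rw [h]
    have := p.off_nonneg i
    have := q.off_nonneg j
    positivity

theorem pathDist_le_through (p q : MetricGraphRep G hG) (i j : Bool) :
    p.pathDist q ≤ p.off i + (G.dist (p.vert i) (q.vert j) : ℝ) + q.off j := by
  have hp0 := p.pos_nonneg
  have hp1 := p.pos_le_one
  have hq0 := q.pos_nonneg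
  have hq1 := q.pos_le_one
  have hd : (0 : ℝ) ≤ (G.dist (p.vert i) (q.vert j) : ℝ) := Nat.cast_nonneg _
  by_cases h1 : p.src = q.src ∧ p.tgt = q.tgt
  · rw [pathDist, if_pos h1]
    rcases q.valid with ha | ⟨he, hz⟩
    · have e1 : (G.dist q.src q.tgt : ℝ) = 1 := by
        rw [SimpleGraph.dist_eq_one_iff_adj.2 ha]; simp
      have e2 : (G.dist q.tgt q.src : ℝ) = 1 := by
        rw [SimpleGraph.dist_eq_one_iff_adj.2 ha.symm]; simp
      cases i <;> cases j <;> simp only [vert, off, h1.1, h1.2, e1, e2] at * <;>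
        rw [abs_le] <;> constructor <;> linarith
    · have hz' : p.pos = 0 := by
        rcases p.valid with hb | ⟨-, hb⟩
        · exact absurd (by rw [h1.1, h1.2, he]) hb.ne
        · exact hb
      have := p.off_nonneg i
      have := q.off_nonneg j
      rw [hz, hz']; simp only [sub_self, abs_zero]; positivity
  by_cases h2 : p.src = q.tgt ∧ p.tgt = q.src
  · rw [pathDist, if_neg h1, if_pos h2]
    rcases q.valid with ha | ⟨he, hz⟩
    · have e1 : (G.dist q.src q.tgt : ℝ) = 1 := by
        rw [SimpleGraph.dist_eq_one_iff_adj.2 ha]; simp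
      have e2 : (G.dist q.tgt q.src : ℝ) = 1 := by
        rw [SimpleGraph.dist_eq_one_iff_adj.2 ha.symm]; simp
      cases i <;> cases j <;> simp only [vert, off, h2.1, h2.2, e1, e2] at * <;>
        rw [abs_le] <;> constructor <;> linarith
    · exact absurd ⟨by rw [h2.1, he], by rw [h2.2, he]⟩ h1
  · rw [pathDist, if_neg h1, if_neg h2]
    exact ciInf_le (through_bddBelow p q) (i, j)

theorem pathDist_self (p : MetricGraphRep G hG) : p.pathDist p = 0 := by
  simp [pathDist]

theorem pathDist_comm_le (p q : MetricGraphRep G hG) : p.pathDist q ≤ q.pathDist p := by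
  rcases pathDist_cases q p with ⟨h1, h2, h⟩ | ⟨h1, h2, h⟩ | ⟨i, j, h⟩
  · rw [h, pathDist, if_pos ⟨h1.symm, h2.symm⟩, abs_sub_comm]
  · rw [h, pathDist]
    split_ifs with h3 h4
    · have hq : q.src = q.tgt := h1.trans h3.2
      have hz : q.pos = 0 := by
        rcases q.valid with hb | ⟨-, hb⟩
        · exact absurd hq hb.ne
        · exact hb
      have hz' : p.pos = 0 := by
        rcases p.valid with hb | ⟨-, hb⟩
        · exact absurd (h3.1.trans h1 ) hb.ne
        · exact hb
      simp [hz, hz']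
    · rw [show p.pos - (1 - q.pos) = q.pos - (1 - p.pos) by ring]
    · exact absurd ⟨h2.symm, h1.symm⟩ h4
  · rw [h]
    have := pathDist_le_through p q j i
    rw [SimpleGraph.dist_comm] at this
    linarith

/-- Moving along an edge changes the distance to each endpoint by at most the distance moved. -/
theorem along_off {p q : MetricGraphRep G hG}
    (h : (p.src = q.src ∧ p.tgt = q.tgt ∧ p.pathDist q = |p.pos - q.pos|) ∨
      (p.src = q.tgt ∧ p.tgt = q.src ∧ p.pathDist q = |p.pos - (1 - q.pos)|)) (j : Bool) :
    ∃ i, p.vert i = q.vert j ∧ p.off i ≤ p.pathDist q + q.off j := by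
  rcases h with ⟨h1, h2, h⟩ | ⟨h1, h2, h⟩
  · have a1 := le_abs_self (p.pos - q.pos)
    have a2 := neg_abs_le (p.pos - q.pos)
    refine ⟨j, ?_, ?_⟩ <;> cases j <;> simp only [vert, off, h1, h2, h] <;> linarith
  · have a1 := le_abs_self (p.pos - (1 - q.pos))
    have a2 := neg_abs_le (p.pos - (1 - q.pos))
    refine ⟨!j, ?_, ?_⟩ <;> cases j <;>
      simp only [vert, off, h1, h2, h, Bool.not_true, Bool.not_false] <;> linarith

theorem pathDist_comm (p q : MetricGraphRep G hG) : p.pathDist q = q.pathDist p :=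
  le_antisymm (pathDist_comm_le p q) (pathDist_comm_le q p)

theorem triangle_along_through {p q r : MetricGraphRep G hG}
    (h : (p.src = q.src ∧ p.tgt = q.tgt ∧ p.pathDist q = |p.pos - q.pos|) ∨
      (p.src = q.tgt ∧ p.tgt = q.src ∧ p.pathDist q = |p.pos - (1 - q.pos)|))
    {j k : Bool} (h' : q.pathDist r = q.off j + (G.dist (q.vert j) (r.vert k) : ℝ) + r.off k) :
    p.pathDist r ≤ p.pathDist q + q.pathDist r := by
  obtain ⟨i, hi, ho⟩ := along_off h j
  have := pathDist_le_through p r i k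
  rw [hi] at this
  linarith

theorem pathDist_triangle (p q r : MetricGraphRep G hG) :
    p.pathDist r ≤ p.pathDist q + q.pathDist r := by
  rcases or_assoc.2 (pathDist_cases p q) with h | ⟨i, j, h⟩ <;>
    rcases or_assoc.2 (pathDist_cases q r) with h' | ⟨j', k, h'⟩
  · rcases h with ⟨h1, h2, h⟩ | ⟨h1, h2, h⟩ <;> rcases h' with ⟨h1', h2', h'⟩ | ⟨h1', h2', h'⟩
    · rw [h, h', pathDist, if_pos ⟨h1.trans h1', h2.trans h2'⟩]
      exact abs_sub_le _ _ _
    · rw [h, h', pathDist]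
      split_ifs with h3 h4
      · rw [abs_le]
        have hq : p.src = p.tgt := by rw [h3.1, h2, h2']
        have hz : p.pos = 0 := by
          rcases p.valid with hb | ⟨-, hb⟩
          · exact absurd hq hb.ne
          · exact hb
        have hz' : r.pos = 0 := by
          rcases r.valid with hb | ⟨-, hb⟩
          · exact absurd (by rw [← h3.1, ← h3.2, hq]) hb.ne
          · exact hb
        rw [hz, hz']
        have := abs_nonneg (0 - q.pos)
        have := abs_nonneg (q.pos - (1 - 0))
        constructor <;> linarith
      · exact abs_sub_le _ _ _
      · exact absurd ⟨h1.trans h1', h2.trans h2'⟩ h4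
    · rw [h, h', pathDist]
      have e : |q.pos - r.pos| = |(1 - q.pos) - (1 - r.pos)| := by
        rw [abs_sub_comm]; congr 1; ring
      split_ifs with h3 h4
      · have hq : p.src = p.tgt := by rw [h3.1, h2, h1']
        have hz : p.pos = 0 := by
          rcases p.valid with hb | ⟨-, hb⟩
          · exact absurd hq hb.ne
          · exact hb
        have hz' : r.pos = 0 := by
          rcases r.valid with hb | ⟨-, hb⟩
          · exact absurd (by rw [← h3.1, ← h3.2, hq]) hb.ne
          · exact hb
        rw [hz, hz']
        have := abs_nonneg (0 - (1 - q.pos))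
        have := abs_nonneg (q.pos - 0)
        simp only [sub_self, abs_zero]; linarith
      · rw [e]; exact abs_sub_le _ _ _
      · exact absurd ⟨h1.trans h2', h2.trans h1'⟩ h4
    · rw [h, h', pathDist, if_pos ⟨h1.trans h2', h2.trans h1'⟩]
      have e : |q.pos - (1 - r.pos)| = |(1 - q.pos) - r.pos| := by
        rw [abs_sub_comm]; congr 1; ring
      rw [e]; exact abs_sub_le _ _ _
  · exact triangle_along_through h h'
  · have h'' : (r.src = q.src ∧ r.tgt = q.tgt ∧ r.pathDist q = |r.pos - q.pos|) ∨
        (r.src = q.tgt ∧ r.tgt = q.src ∧ r.pathDist q = |r.pos - (1 - q.pos)|) := by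
      rw [pathDist_comm r q]
      rcases h' with ⟨h1, h2, h'⟩ | ⟨h1, h2, h'⟩
      · exact Or.inl ⟨h1.symm, h2.symm, by rw [h', abs_sub_comm]⟩
      · exact Or.inr ⟨h2.symm, h1.symm, by
          rw [h', show q.pos - (1 - r.pos) = r.pos - (1 - q.pos) by ring]⟩
    have h3 : q.pathDist p = q.off j + (G.dist (q.vert j) (p.vert i) : ℝ) + p.off i := by
      rw [pathDist_comm q p, h, SimpleGraph.dist_comm]; ring
    have := triangle_along_through h'' h3
    rw [pathDist_comm r p, pathDist_comm r q, pathDist_comm q p] at this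
    linarith
  · have t := pathDist_le_through p r i k
    have tri : ∀ a b c : V, (G.dist a c : ℝ) ≤ G.dist a b + G.dist b c := fun a b c => by
      exact_mod_cast hG.dist_triangle
    have o1 := q.off_nonneg j
    have o2 := q.off_nonneg j'
    have t1 := tri (p.vert i) (q.vert j) (r.vert k)
    by_cases hjj : j = j'
    · subst hjj
      linarith
    · have t2 := tri (q.vert j) (q.vert j') (r.vert k)
      have t3 := q.dist_vert_le j j' hjj
      linarith

noncomputable instance : PseudoMetricSpace (MetricGraphRep G hG) where
  dist := pathDist
  dist_self := pathDist_self
  dist_comm := pathDist_comm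
  dist_triangle := pathDist_triangle

end MetricGraphRep

/-- The metric graph of a connected graph, every edge being isometric to `[0, 1]`: representatives
at distance zero are identified. It is a metric space with the path distance. -/
abbrev MetricGraph {V : Type*} (G : SimpleGraph V) (hG : G.Connected) : Type _ :=
  SeparationQuotient (MetricGraphRep G hG)

/-! ### Hyperbolic spaces -/

/-- The Gromov product `(x|y)_o`. -/
noncomputable def gromovProduct {X : Type*} [MetricSpace X] (o x y : X) : ℝ :=
  (dist x o + dist y o - dist x y) / 2

/-- Gromov hyperbolicity, by the `δ`-inequality. -/
def IsGromovHyperbolic (X : Type*) [MetricSpace X] : Prop :=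
  ∃ δ : ℝ, 0 ≤ δ ∧ ∀ o x y z : X,
    min (gromovProduct o x z) (gromovProduct o z y) - δ ≤ gromovProduct o x y

/-- `X` has a pole: for some point `v` and some `M > 0`, every point of `X` is at distance less
than `M` from some geodesic ray emanating from `v`. -/
def HasPole (X : Type*) [MetricSpace X] : Prop :=
  ∃ v : X, ∃ M : ℝ, 0 < M ∧ ∀ x : X,
    ∃ γ : ℝ≥0 → X, Isometry γ ∧ γ 0 = v ∧ ∃ t : ℝ≥0, dist x (γ t) < M

/-- A metric space is uniformly perfect if for some `S > 1` and `ε₀ > 0`, every `x` and every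
`0 < ε ≤ ε₀` admit a point `y` with `ε / S < d(x, y) ≤ ε`. -/
def IsUniformlyPerfect (Y : Type*) [MetricSpace Y] : Prop :=
  ∃ S : ℝ, 1 < S ∧ ∃ ε₀ : ℝ, 0 < ε₀ ∧ ∀ x : Y, ∀ ε : ℝ, 0 < ε → ε ≤ ε₀ →
    ∃ y : Y, ε / S < dist x y ∧ dist x y ≤ ε

/-! ### The sequential boundary at infinity -/

/-- The sequence `x` converges to infinity: `(x_i|x_j)_o → ∞` as `i, j → ∞`. -/
def ConvergesToInfinity {X : Type*} [MetricSpace X] (x : ℕ → X) : Prop :=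
  ∀ o : X, Tendsto (fun ij : ℕ × ℕ => gromovProduct o (x ij.1) (x ij.2)) atTop atTop

theorem gromovProduct_comm {X : Type*} [MetricSpace X] (o x y : X) :
    gromovProduct o x y = gromovProduct o y x := by
  simp only [gromovProduct, dist_comm x y]; ring

/-- Equivalence of sequences converging to infinity: `(x_i|y_i)_o → ∞`. -/
def boundarySetoid {X : Type*} [MetricSpace X] (hX : IsGromovHyperbolic X) :
    Setoid {x : ℕ → X // ConvergesToInfinity x} where
  r x y := ∀ o : X, Tendsto (fun i => gromovProduct o (x.1 i) (y.1 i)) atTop atTop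
  iseqv :=
    { refl := fun x o => (x.2 o).comp (tendsto_atTop_diagonal (α := ℕ))
      symm := fun {x y} h o => by
        simpa only [gromovProduct_comm o (x.1 _) (y.1 _)] using h o
      trans := fun {x y z} h h' o => by
        obtain ⟨δ, -, hδ⟩ := hX
        refine tendsto_atTop_mono (fun i => hδ o (x.1 i) (z.1 i) (y.1 i)) ?_
        refine tendsto_atTop_add_const_right _ (-δ) ?_
        rw [tendsto_atTop]
        intro b
        filter_upwards [(tendsto_atTop.1 (h o)) b, (tendsto_atTop.1 (h' o)) b] with i h1 h2
        exact le_min h1 h2 }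

/-- The sequential boundary at infinity of a hyperbolic space. -/
def GromovBoundary (X : Type*) [MetricSpace X] (hX : IsGromovHyperbolic X) : Type _ :=
  Quotient (boundarySetoid hX)

/-- The Gromov product of two boundary points, `inf liminf_i (x_i|y_i)_o` over all sequences
representing them; it is infinite when the two points coincide. The Gromov products `(x_i|y_i)_o`
are nonnegative, so that taking values in `[0, ∞]` loses nothing. -/
noncomputable def boundaryProduct {X : Type*} [MetricSpace X] {hX : IsGromovHyperbolic X}
    (o : X) (ξ η : GromovBoundary X hX) : ℝ≥0∞ :=
  ⨅ (x : {x : ℕ → X // ConvergesToInfinity x}) (y : {x : ℕ → X // ConvergesToInfinity x})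
    (_ : Quotient.mk (boundarySetoid hX) x = ξ) (_ : Quotient.mk (boundarySetoid hX) y = η),
    liminf (fun i => ENNReal.ofReal (gromovProduct o (x.1 i) (y.1 i))) atTop

/-- `a ^ (-t)` for `a > 1` and `t ∈ [0, ∞]`, with `a ^ (-∞) = 0`. -/
noncomputable def expNeg (a : ℝ) (t : ℝ≥0∞) : ℝ :=
  if t = ∞ then 0 else a ^ (-t.toReal)

/-- The metric `d` on the boundary is visual: it is comparable with `a ^ (-(ξ|η)_o)` for some base
point `o` and some parameter `a > 1`. -/
def IsVisualMetric {X : Type*} [MetricSpace X] {hX : IsGromovHyperbolic X}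
    (d : MetricSpace (GromovBoundary X hX)) : Prop :=
  ∃ (o : X) (a c₁ c₂ : ℝ), 1 < a ∧ 0 < c₁ ∧ 0 < c₂ ∧ ∀ ξ η : GromovBoundary X hX,
    c₁ * expNeg a (boundaryProduct o ξ η) ≤ d.dist ξ η ∧
      d.dist ξ η ≤ c₂ * expNeg a (boundaryProduct o ξ η)

/-! A positive Cheeger constant means uniform branching. The heart of the forward direction is
`exists_infinite_directions`: for some `t`, from every vertex `p` and for any two vertices `x₁`,
`x₂`, infinitely many vertices `y` satisfy `(y|x₁)_p, (y|x₂)_p ≤ t`. To see this, let `f` be the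
minimum of two functions comparable with `a ^ (-(y|xᵢ)_p)` that change by at most `a ^ (-(y|z)_p)`
from `y` to `z`, hence very little along edges far from `p`. Isoperimetry makes the superlevel sets
of `f` grow by a factor `1 + h` each time the level drops far enough to absorb one edge. Dropping
the level by a constant factor always suffices, so after `k` drops there are at least `(1 + h) ^ k`
vertices. From then on a relative drop of order `a ^ (-L)` suffices, apart from vertices near
initial segments of the geodesics `[p, xᵢ]`, of which there are at most a multiple of `k * D ^ L`.
Once the exponential beats this linear factor, increasing `L` gradually makes the count blow up
before the level is halved (`exists_bound_of_growth`), so that superlevel set is infinite. König's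
lemma turns such directions into rays. Directions at `x` away from `o` give a ray from `o` passing
near `x`, hence a pole. Directions at a point `p` of a geodesic from `o` towards `ξ`, away from both
ends, give boundary points `η` with `(ξ|η)_o` close to `d(o, p)`, hence uniform perfectness.
Conversely, the pole supplies a boundary point behind every vertex `x`, and uniform perfectness
supplies arbitrarily many others branching off it beyond `x` at well separated heights. Cut at
height `d(o, x) + R`, they become distinct vertices (`exists_many_descendants`). Moving these `R`
steps back towards `o` lands near `x`, and double counting shows that a neighbourhood of fixed
radius of any finite `A` has at least `2|A|` vertices (`exists_isoperimetry_of_preimages`); since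
balls of fixed radius around `∂A` cover the added vertices, `∂A` is large. -/

/-! ### The vertices of the metric graph -/

namespace MetricGraph

variable {V : Type*} {G : SimpleGraph V}

/-- A vertex, as a point of the metric graph. -/
noncomputable def vertex (hG : G.Connected) (v : V) : MetricGraph G hG :=
  SeparationQuotient.mk ⟨v, v, 0, le_rfl, zero_le_one, Or.inr ⟨rfl, rfl⟩⟩

theorem dist_mk {hG : G.Connected} (p q : MetricGraphRep G hG) :
    dist (SeparationQuotient.mk p : MetricGraph G hG) (SeparationQuotient.mk q) = p.pathDist q :=
  SeparationQuotient.dist_mk p q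

@[simp]
theorem dist_vertex (hG : G.Connected) (u v : V) :
    dist (vertex hG u) (vertex hG v) = G.dist u v := by
  rw [vertex, vertex, dist_mk]
  apply le_antisymm
  · refine (MetricGraphRep.pathDist_le_through _ _ false false).trans ?_
    simp [MetricGraphRep.vert, MetricGraphRep.off]
  · rcases MetricGraphRep.pathDist_cases (⟨u, u, 0, le_rfl, zero_le_one, Or.inr ⟨rfl, rfl⟩⟩ :
      MetricGraphRep G hG) ⟨v, v, 0, le_rfl, zero_le_one, Or.inr ⟨rfl, rfl⟩⟩ with
      ⟨h1, -, h⟩ | ⟨h1, -, h⟩ | ⟨i, j, h⟩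
    · rw [h, show u = v from h1]; simp
    · rw [h, show u = v from h1]; simp
    · rw [h]
      cases i <;> cases j <;> simp only [MetricGraphRep.vert, MetricGraphRep.off] <;> linarith

theorem exists_dist_vertex_le {hG : G.Connected} (x : MetricGraph G hG) :
    ∃ v, dist x (vertex hG v) ≤ 1 := by
  obtain ⟨p, rfl⟩ := SeparationQuotient.surjective_mk x
  refine ⟨p.src, ?_⟩
  rw [vertex, dist_mk]
  refine (MetricGraphRep.pathDist_le_through _ _ false false).trans ?_
  simpa [MetricGraphRep.vert, MetricGraphRep.off] using p.pos_le_one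

/-- The path in the metric graph that runs through the edges of a sequence of vertices at unit
speed. -/
noncomputable def unitSpeedPath (hG : G.Connected) (f : ℕ → V)
    (hf : ∀ n, G.Adj (f n) (f (n + 1))) (t : ℝ≥0) : MetricGraph G hG :=
  SeparationQuotient.mk ⟨f ⌊t⌋₊, f (⌊t⌋₊ + 1), t - ⌊t⌋₊,
    sub_nonneg.2 (by exact_mod_cast Nat.floor_le (zero_le (a := t))),
    by
      have : (t : ℝ) < ⌊t⌋₊ + 1 := by exact_mod_cast Nat.lt_floor_add_one t
      linarith, Or.inl (hf _)⟩

variable (hG : G.Connected) (f : ℕ → V) (hf : ∀ n, G.Adj (f n) (f (n + 1)))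

theorem dist_unitSpeedPath_floor (t : ℝ≥0) :
    dist (unitSpeedPath hG f hf t) (vertex hG (f ⌊t⌋₊)) ≤ t - ⌊t⌋₊ := by
  rw [vertex, unitSpeedPath, dist_mk]
  refine (MetricGraphRep.pathDist_le_through _ _ false false).trans ?_
  simp [MetricGraphRep.vert, MetricGraphRep.off]

theorem dist_unitSpeedPath_floor_succ (t : ℝ≥0) :
    dist (unitSpeedPath hG f hf t) (vertex hG (f (⌊t⌋₊ + 1))) ≤ ⌊t⌋₊ + 1 - t := by
  rw [vertex, unitSpeedPath, dist_mk]
  refine (MetricGraphRep.pathDist_le_through _ _ true false).trans ?_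
  simp only [MetricGraphRep.vert, MetricGraphRep.off, SimpleGraph.dist_self]
  apply le_of_eq; push_cast; ring

theorem unitSpeedPath_natCast (n : ℕ) : unitSpeedPath hG f hf n = vertex hG (f n) := by
  have := dist_unitSpeedPath_floor hG f hf n
  rw [Nat.floor_natCast] at this
  simp only [NNReal.coe_natCast, sub_self] at this
  exact dist_le_zero.1 this

theorem _root_.SimpleGraph.Connected.dist_path_le {V : Type*} {G : SimpleGraph V}
    (hG : G.Connected) (f : ℕ → V) (hf : ∀ n, G.Adj (f n) (f (n + 1))) (m n : ℕ) (h : m ≤ n) : (G.dist (f m) (f n) : ℝ) ≤ n - m := by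
  induction n, h using Nat.le_induction with
  | base => simp
  | succ n hmn ih =>
    have h1 : (G.dist (f m) (f (n + 1)) : ℝ) ≤ G.dist (f m) (f n) + G.dist (f n) (f (n + 1)) := by
      exact_mod_cast hG.dist_triangle
    rw [SimpleGraph.dist_eq_one_iff_adj.2 (hf n)] at h1
    push_cast at *
    linarith

/-- Inside one edge this is the length of a segment; otherwise the path is cut at the first vertex
after time `s` and the last one before time `t`. -/
theorem dist_unitSpeedPath_le {s t : ℝ≥0} (h : s ≤ t) :
    dist (unitSpeedPath hG f hf s) (unitSpeedPath hG f hf t) ≤ t - s := by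
  rcases (Nat.floor_mono h).eq_or_lt with he | hl
  · have : (unitSpeedPath hG f hf s) = SeparationQuotient.mk ⟨f ⌊t⌋₊, f (⌊t⌋₊ + 1), s - ⌊t⌋₊,
        sub_nonneg.2 (by rw [← he]; exact_mod_cast Nat.floor_le (zero_le (a := s))),
        by
          have : (s : ℝ) < ⌊s⌋₊ + 1 := by exact_mod_cast Nat.lt_floor_add_one s
          rw [← he]; linarith, Or.inl (hf _)⟩ := by
      simp only [unitSpeedPath, he]
    rw [this, unitSpeedPath, dist_mk, MetricGraphRep.pathDist, if_pos ⟨rfl, rfl⟩]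
    have : (s : ℝ) ≤ t := h
    rw [abs_le]; constructor <;> simp only <;> linarith
  · have h1 := dist_unitSpeedPath_floor_succ hG f hf s
    have h2 := dist_unitSpeedPath_floor hG f hf t
    have h3 := hG.dist_path_le f hf _ _ (Nat.succ_le_of_lt hl)
    rw [← dist_vertex hG] at h3
    have h4 := dist_triangle4 (unitSpeedPath hG f hf s) (vertex hG (f (⌊s⌋₊ + 1)))
      (vertex hG (f ⌊t⌋₊)) (unitSpeedPath hG f hf t)
    rw [dist_comm (vertex hG (f ⌊t⌋₊)) (unitSpeedPath hG f hf t)] at h4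
    push_cast at h3
    linarith

/-- A 1-Lipschitz path that realises the distance between times `0` and `n` cannot lose length on
any subinterval. -/
theorem isometry_unitSpeedPath (hd : ∀ n, G.dist (f 0) (f n) = n) :
    Isometry (unitSpeedPath hG f hf) := by
  have key : ∀ s t : ℝ≥0, s ≤ t →
      dist (unitSpeedPath hG f hf s) (unitSpeedPath hG f hf t) = t - s := by
    intro s t h
    refine le_antisymm (dist_unitSpeedPath_le hG f hf h) ?_
    obtain ⟨n, hn⟩ := exists_nat_ge t
    have h1 := dist_unitSpeedPath_le hG f hf (zero_le (a := s))
    have h2 := dist_unitSpeedPath_le hG f hf hn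
    have h3 := dist_triangle4 (unitSpeedPath hG f hf 0) (unitSpeedPath hG f hf s)
      (unitSpeedPath hG f hf t) (unitSpeedPath hG f hf n)
    have h4 : dist (unitSpeedPath hG f hf 0) (unitSpeedPath hG f hf n) = n := by
      have : unitSpeedPath hG f hf 0 = vertex hG (f 0) := by
        simpa using unitSpeedPath_natCast hG f hf 0
      rw [this, unitSpeedPath_natCast, dist_vertex, hd]
    simp only [NNReal.coe_zero, NNReal.coe_natCast] at h1 h2
    linarith
  refine Isometry.of_dist_eq fun s t => ?_
  rw [NNReal.dist_eq]
  rcases le_total s t with h | h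
  · rw [key s t h, abs_sub_comm, abs_of_nonneg (sub_nonneg.2 (by exact_mod_cast h))]
  · rw [dist_comm, key t s h, abs_of_nonneg (sub_nonneg.2 (by exact_mod_cast h))]

end MetricGraph

/-! ### Geodesics and balls of vertices -/

namespace SimpleGraph

variable {V : Type*} {G : SimpleGraph V}

/-- A connected graph has geodesics: there are vertices at every intermediate distance. -/
theorem Connected.exists_dist_eq (hG : G.Connected) (u v : V) {n : ℕ} (hn : n ≤ G.dist u v) :
    ∃ w, G.dist u w = n ∧ n + G.dist w v = G.dist u v := by
  obtain ⟨p, hp⟩ := hG.exists_walk_length_eq_dist u v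
  refine ⟨p.getVert n, ?_⟩
  have h1 := dist_le (p.take n)
  have h2 := dist_le (p.drop n)
  have h3 : G.dist u v ≤ G.dist u (p.getVert n) + G.dist (p.getVert n) v := hG.dist_triangle
  rw [Walk.take_length] at h1
  rw [Walk.drop_length] at h2
  omega

/-- The vertices at distance at most `n` from `v`. -/
def distBall (G : SimpleGraph V) (v : V) (n : ℕ) : Set V := {w | G.dist v w ≤ n}

theorem mem_distBall {v w : V} {n : ℕ} : w ∈ G.distBall v n ↔ G.dist v w ≤ n := Iff.rfl

theorem Connected.distBall_succ_subset (hG : G.Connected) (v : V) (n : ℕ) :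
    G.distBall v (n + 1) ⊆ ⋃ w ∈ G.distBall v n, insert w (G.neighborSet w) := by
  intro u hu
  rw [mem_distBall] at hu
  simp only [mem_iUnion]
  rcases Nat.lt_or_ge n (G.dist v u) with h | h
  · obtain ⟨w, h1, h2⟩ := hG.exists_dist_eq v u h.le
    refine ⟨w, h1.le, Or.inr ?_⟩
    rw [mem_neighborSet, ← dist_eq_one_iff_adj]
    omega
  · exact ⟨u, h, Or.inl rfl⟩

theorem Connected.distBall_finite_ncard_le (hG : G.Connected) {D : ℕ}
    (hD : ∀ v : V, (insert v (G.neighborSet v)).Finite ∧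
      (insert v (G.neighborSet v)).ncard ≤ D) (v : V) (n : ℕ) :
    (G.distBall v n).Finite ∧ (G.distBall v n).ncard ≤ D ^ n := by
  induction n with
  | zero =>
    have : G.distBall v 0 = {v} := by
      ext w
      rw [mem_distBall, Nat.le_zero, hG.dist_eq_zero_iff]
      exact eq_comm
    simp [this]
  | succ n ih =>
    have hfin := ih.1.biUnion (fun w _ => (hD w).1)
    refine ⟨hfin.subset (hG.distBall_succ_subset v n),
      (ncard_le_ncard (hG.distBall_succ_subset v n) hfin).trans ?_⟩
    classical
    have h1 : (⋃ w ∈ G.distBall v n, insert w (G.neighborSet w)) =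
        ((ih.1.toFinset.biUnion fun w => (hD w).1.toFinset : Finset V) : Set V) := by
      ext; simp
    rw [h1, ncard_coe_finset]
    refine (Finset.card_biUnion_le_card_mul _ _ D fun w _ => ?_).trans ?_
    · rw [← ncard_eq_toFinset_card _ (hD w).1]; exact (hD w).2
    · rw [pow_succ, ← ncard_eq_toFinset_card _ ih.1]
      exact Nat.mul_le_mul_right _ ih.2

/-- König's lemma, for geodesics towards an infinite set of vertices. -/
theorem Connected.exists_ray (hG : G.Connected) (hfin : ∀ v, (G.neighborSet v).Finite)
    (o : V) {Z : Set V} (hZ : Z.Infinite) :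
    ∃ f : ℕ → V, f 0 = o ∧ (∀ n, G.Adj (f n) (f (n + 1))) ∧ (∀ n, G.dist o (f n) = n) ∧
      ∀ n, {y ∈ Z | G.dist o y = n + G.dist (f n) y}.Infinite := by
  -- `S v` consists of the targets having a geodesic from `o` through `v`. It is covered by `{v}`
  -- and the sets `S w` of the finitely many neighbours `w` one step farther from `o`, so if `S v`
  -- is infinite, so is one of these.
  let S : V → Set V := fun v => {y ∈ Z | G.dist o y = G.dist o v + G.dist v y}
  have hS : ∀ v : {v // (S v).Infinite}, ∃ w : {w // (S w).Infinite},
      G.Adj v w ∧ G.dist o w = G.dist o v + 1 := by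
    rintro ⟨v, hv⟩
    by_contra! hcon
    have : S v ⊆ {v} ∪ ⋃ w ∈ {w ∈ G.neighborSet v | G.dist o w = G.dist o v + 1}, S w := by
      rintro y ⟨hyZ, hy⟩
      rcases Nat.eq_zero_or_pos (G.dist v y) with h0 | hpos
      · exact Or.inl (hG.dist_eq_zero_iff.1 h0).symm
      · obtain ⟨w, h1, h2⟩ := hG.exists_dist_eq v y hpos
        have h3 : G.dist o w ≤ G.dist o v + G.dist v w := hG.dist_triangle
        have h4 : G.dist o y ≤ G.dist o w + G.dist w y := hG.dist_triangle
        refine Or.inr (mem_biUnion (x := w) ⟨dist_eq_one_iff_adj.1 h1, by omega⟩ ⟨hyZ, by omega⟩)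
    refine hv (((finite_singleton v).union
      (((hfin v).subset (sep_subset _ _)).biUnion fun w hw => ?_)).subset this)
    by_contra hinf
    exact hcon ⟨w, hinf⟩ hw.1 hw.2
  choose next hadj hdist using hS
  have ho : (S o).Infinite := by simpa [S] using hZ
  let g : ℕ → {v // (S v).Infinite} := fun n => next^[n] ⟨o, ho⟩
  have hg : ∀ n, g (n + 1) = next (g n) := fun n => Function.iterate_succ_apply' _ _ _
  have hd : ∀ n, G.dist o (g n) = n := by
    intro n
    induction n with
    | zero => simp [g]
    | succ n ih => rw [hg, hdist, ih]
  refine ⟨fun n => g n, rfl, fun n => by simpa only [hg] using hadj (g n), hd, fun n => ?_⟩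
  have := (g n).2
  simpa only [S, hd n] using this

end SimpleGraph

/-! ### Gromov products -/

section GromovProduct

variable {X : Type*} [MetricSpace X]

/-- The `δ`-inequality for Gromov products. -/
def DeltaInequality (X : Type*) [MetricSpace X] (δ : ℝ) : Prop :=
  ∀ o x y z : X, min (gromovProduct o x z) (gromovProduct o z y) - δ ≤ gromovProduct o x y

theorem gromovProduct_nonneg (o x y : X) : 0 ≤ gromovProduct o x y := by
  have := dist_triangle_right x y o
  rw [gromovProduct]; linarith

theorem gromovProduct_le_dist (o x y : X) : gromovProduct o x y ≤ dist x o := by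
  have := dist_triangle_left y o x
  rw [gromovProduct]; linarith

theorem gromovProduct_le_add_dist_right (o x y z : X) :
    gromovProduct o x y ≤ gromovProduct o x z + dist y z := by
  have h1 := dist_triangle y z o
  have h2 := dist_triangle x y z
  rw [gromovProduct, gromovProduct]; linarith

theorem gromovProduct_le_add_dist_left (o x y z : X) :
    gromovProduct o x y ≤ gromovProduct o z y + dist x z := by
  rw [gromovProduct_comm o x y, gromovProduct_comm o z y]
  exact gromovProduct_le_add_dist_right o y x z

theorem gromovProduct_le_add_dist_base (o o' x y : X) :
    gromovProduct o x y ≤ gromovProduct o' x y + dist o o' := by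
  have h1 := dist_triangle_right x o o'
  have h2 := dist_triangle_right y o o'
  rw [gromovProduct, gromovProduct]; linarith

/-- Trades an upper bound for a product based at `p` for a lower bound for one based at `o`. -/
theorem gromovProduct_add_gromovProduct (o p x : X) :
    gromovProduct o p x + gromovProduct p o x = dist o p := by
  rw [gromovProduct, gromovProduct, dist_comm p o, dist_comm x o, dist_comm x p]; ring

/-- If two points have large Gromov products with a third one, then so they have with each
other. -/
theorem DeltaInequality.le_gromovProduct {δ : ℝ} (h : DeltaInequality X δ) {o x y z : X} {t : ℝ}
    (h1 : t ≤ gromovProduct o x z) (h2 : t ≤ gromovProduct o z y) :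
    t - δ ≤ gromovProduct o x y :=
  (sub_le_sub_right (le_min h1 h2) _).trans (h o x y z)

/-- Convergence to infinity need only be checked at one base point. -/
theorem convergesToInfinity_of_base {x : ℕ → X} (o : X)
    (h : Tendsto (fun ij : ℕ × ℕ => gromovProduct o (x ij.1) (x ij.2)) atTop atTop) :
    ConvergesToInfinity x := fun o' =>
  tendsto_atTop_mono (fun ij => by
    have := gromovProduct_le_add_dist_base o o' (x ij.1) (x ij.2)
    show gromovProduct o (x ij.1) (x ij.2) + (-dist o o') ≤ _
    linarith) (tendsto_atTop_add_const_right _ (-dist o o') h)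

theorem ConvergesToInfinity.eventually_ge {x : ℕ → X} (h : ConvergesToInfinity x) (o : X) (b : ℝ) :
    ∃ N, ∀ i j, N ≤ i → N ≤ j → b ≤ gromovProduct o (x i) (x j) := by
  have := (tendsto_atTop.1 (h o)) b
  rw [eventually_atTop] at this
  obtain ⟨⟨a, c⟩, h⟩ := this
  exact ⟨max a c, fun i j hi hj => h (i, j)
    ⟨(le_max_left _ _).trans hi, (le_max_right _ _).trans hj⟩⟩

theorem ConvergesToInfinity.of_eventually_ge {x : ℕ → X} (o : X)
    (h : ∀ b : ℝ, ∃ N, ∀ i j, N ≤ i → N ≤ j → b ≤ gromovProduct o (x i) (x j)) :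
    ConvergesToInfinity x := by
  refine convergesToInfinity_of_base o (tendsto_atTop.2 fun b => ?_)
  obtain ⟨N, hN⟩ := h b
  exact eventually_atTop.2 ⟨(N, N), fun ij hij => hN _ _ hij.1 hij.2⟩

end GromovProduct

/-! ### Quasi-ultrametrics are comparable with metrics -/

theorem expNeg_top (a : ℝ) : expNeg a ∞ = 0 := if_pos rfl

theorem expNeg_of_ne_top (a : ℝ) {t : ℝ≥0∞} (ht : t ≠ ∞) : expNeg a t = a ^ (-t.toReal) :=
  if_neg ht

theorem expNeg_ofReal (a : ℝ) {t : ℝ} (ht : 0 ≤ t) : expNeg a (ENNReal.ofReal t) = a ^ (-t) := by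
  rw [expNeg_of_ne_top a ENNReal.ofReal_ne_top, ENNReal.toReal_ofReal ht]

theorem expNeg_nonneg {a : ℝ} (ha : 1 < a) (t : ℝ≥0∞) : 0 ≤ expNeg a t := by
  rw [expNeg]
  split_ifs
  · exact le_rfl
  · positivity

theorem expNeg_pos {a : ℝ} (ha : 1 < a) {t : ℝ≥0∞} (ht : t ≠ ∞) : 0 < expNeg a t := by
  rw [expNeg_of_ne_top a ht]
  positivity

theorem expNeg_le_rpow {a : ℝ} (ha : 1 < a) {t : ℝ≥0∞} {s : ℝ} (hs : ENNReal.ofReal s ≤ t) :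
    expNeg a t ≤ a ^ (-s) := by
  by_cases ht : t = ∞
  · rw [ht, expNeg_top]; positivity
  · rw [expNeg_of_ne_top a ht]
    refine Real.rpow_le_rpow_of_exponent_le ha.le (neg_le_neg ?_)
    rcases le_total s 0 with h | h
    · exact h.trans ENNReal.toReal_nonneg
    · exact (ENNReal.ofReal_le_iff_le_toReal ht).1 hs

theorem rpow_le_expNeg {a : ℝ} (ha : 1 < a) {t : ℝ≥0∞} {s : ℝ} (h0 : 0 ≤ s)
    (hs : t ≤ ENNReal.ofReal s) : a ^ (-s) ≤ expNeg a t := by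
  have ht : t ≠ ∞ := (hs.trans_lt ENNReal.ofReal_lt_top).ne
  rw [expNeg_of_ne_top a ht]
  exact Real.rpow_le_rpow_of_exponent_le ha.le (neg_le_neg (ENNReal.toReal_le_of_le_ofReal h0 hs))

theorem expNeg_anti_add {a : ℝ} (ha : 1 < a) {s t : ℝ≥0∞} {c : ℝ} (hc : 0 ≤ c)
    (h : s ≤ t + ENNReal.ofReal c) : expNeg a t ≤ a ^ c * expNeg a s := by
  by_cases ht : t = ∞
  · rw [ht, expNeg_top]
    exact mul_nonneg (by positivity) (expNeg_nonneg ha _)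
  · have hs : s ≠ ∞ := (h.trans_lt (ENNReal.add_lt_top.2 ⟨lt_top_iff_ne_top.2 ht,
      ENNReal.ofReal_lt_top⟩)).ne
    rw [expNeg_of_ne_top a ht, expNeg_of_ne_top a hs, ← Real.rpow_add (by linarith)]
    refine Real.rpow_le_rpow_of_exponent_le ha.le ?_
    have := ENNReal.toReal_mono (by simp [ht]) h
    rw [ENNReal.toReal_add ht ENNReal.ofReal_ne_top, ENNReal.toReal_ofReal hc] at this
    linarith

/-- A symmetric function `q` with values in `[0, ∞]`, infinite on the diagonal, which satisfies the
`δ`-inequality: `a ^ (-q)` is comparable with a pseudometric. -/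
theorem exists_pseudoMetric_of_delta {Y : Type*} (q : Y → Y → ℝ≥0∞) {δ a : ℝ} (hδ : 0 ≤ δ)
    (ha : 1 < a) (haδ : a ^ (2 * δ) ≤ 2) (hself : ∀ x, q x x = ∞) (hcomm : ∀ x y, q x y = q y x)
    (hq : ∀ x y z, min (q x y) (q y z) ≤ q x z + ENNReal.ofReal δ) :
    ∃ d : PseudoMetricSpace Y, ∀ x y, d.dist x y ≤ expNeg a (q x y) ∧
      expNeg a (q x y) ≤ 2 * d.dist x y := by
  let e : Y → Y → ℝ≥0 := fun x y => ⟨expNeg a (q x y), expNeg_nonneg ha _⟩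
  have e_self : ∀ x, e x x = 0 := fun x => NNReal.eq (by
    change expNeg a (q x x) = 0; rw [hself, expNeg_top])
  have e_comm : ∀ x y, e x y = e y x := fun x y => NNReal.eq (by simp [e, hcomm x y])
  -- Chain construction: the infimum of the `e`-lengths of chains is at least `e / 2` as soon as `e
  -- x₁ x₄` is at most twice the maximum of `e` over three consecutive steps. Two `δ`-inequalities
  -- give this with the factor `a ^ (2 * δ) ≤ 2`.
  refine ⟨PseudoMetricSpace.ofPreNNDist e e_self e_comm, fun x y =>
    ⟨PseudoMetricSpace.dist_ofPreNNDist_le e e_self e_comm x y,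
      PseudoMetricSpace.le_two_mul_dist_ofPreNNDist e e_self e_comm (fun x₁ x₂ x₃ x₄ => ?_) x y⟩⟩
  have h : min (q x₁ x₂) (min (q x₂ x₃) (q x₃ x₄)) ≤ q x₁ x₄ + ENNReal.ofReal (2 * δ) := by
    have h1 := hq x₁ x₂ x₄
    have h2 := hq x₂ x₃ x₄
    rw [two_mul, ENNReal.ofReal_add hδ hδ, ← add_assoc]
    calc min (q x₁ x₂) (min (q x₂ x₃) (q x₃ x₄))
        ≤ min (q x₁ x₂) (q x₂ x₄ + ENNReal.ofReal δ) := min_le_min_left _ h2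
      _ ≤ min (q x₁ x₂ + ENNReal.ofReal δ) (q x₂ x₄ + ENNReal.ofReal δ) :=
          min_le_min_right _ le_self_add
      _ = min (q x₁ x₂) (q x₂ x₄) + ENNReal.ofReal δ := (min_add_add_right _ _ _)
      _ ≤ _ := by gcongr
  have h2 := expNeg_anti_add ha (by positivity : 0 ≤ 2 * δ) h
  rw [← NNReal.coe_le_coe, NNReal.coe_mul, NNReal.coe_max, NNReal.coe_max]
  change expNeg a (q x₁ x₄) ≤ 2 * max (expNeg a (q x₁ x₂)) (max (expNeg a (q x₂ x₃))
    (expNeg a (q x₃ x₄)))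
  have hmax : expNeg a (min (q x₁ x₂) (min (q x₂ x₃) (q x₃ x₄))) ≤
      max (expNeg a (q x₁ x₂)) (max (expNeg a (q x₂ x₃)) (expNeg a (q x₃ x₄))) := by
    rcases min_choice (q x₁ x₂) (min (q x₂ x₃) (q x₃ x₄)) with h | h <;> rw [h]
    · exact le_max_left _ _
    · rcases min_choice (q x₂ x₃) (q x₃ x₄) with h | h <;> rw [h]
      · exact (le_max_left _ _).trans (le_max_right _ _)
      · exact (le_max_right _ _).trans (le_max_right _ _)
  exact h2.trans (mul_le_mul haδ hmax (expNeg_nonneg ha _) zero_le_two)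

theorem exists_base_rpow_le_two {δ : ℝ} (hδ : 0 ≤ δ) : ∃ a : ℝ, 1 < a ∧ a ^ (2 * δ) ≤ 2 := by
  -- The summand `1` in the denominator covers `δ = 0`.
  refine ⟨2 ^ (1 / (2 * δ + 1)), Real.one_lt_rpow one_lt_two (by positivity), ?_⟩
  rw [← Real.rpow_mul zero_le_two]
  calc (2 : ℝ) ^ (1 / (2 * δ + 1) * (2 * δ)) ≤ 2 ^ (1 : ℝ) := by
        refine Real.rpow_le_rpow_of_exponent_le one_le_two ?_
        rw [one_div_mul_eq_div, div_le_one (by positivity)]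
        linarith
    _ = 2 := Real.rpow_one 2

/-- A function comparable with `a ^ (-(x|y)_p)` which varies slowly in `y`. -/
theorem DeltaInequality.exists_slowly_varying {X : Type*} [MetricSpace X] {δ a : ℝ} (hδ : 0 ≤ δ)
    (h : DeltaInequality X δ) (ha : 1 < a) (haδ : a ^ (2 * δ) ≤ 2) (p x : X) :
    ∃ F : X → ℝ, (∀ y, F y ≤ a ^ (-gromovProduct p y x)) ∧
      (∀ y, a ^ (-gromovProduct p y x) ≤ 2 * F y) ∧
      ∀ y z, F y ≤ F z + a ^ (-gromovProduct p y z) := by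
  classical
  -- The chain construction needs `q = ∞` on the diagonal, whereas `(x|x)_p` is finite. With two
  -- copies of `X`, the points `(y, false)` and `(x, true)` always differ, so their `q` is `(y|x)_p`
  -- even for `y = x`. `F` is the distance to `(x, true)`, and its slow variation is the triangle
  -- inequality.
  let q : X × Bool → X × Bool → ℝ≥0∞ := fun y z =>
    if y = z then ∞ else ENNReal.ofReal (gromovProduct p y.1 z.1)
  obtain ⟨d, hd⟩ := exists_pseudoMetric_of_delta q hδ ha haδ (fun y => if_pos rfl)
    (fun y z => by simp only [q, eq_comm, gromovProduct_comm p y.1 z.1])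
    (fun u v w => by
      simp only [q]
      by_cases huw : u = w
      · simp [huw]
      by_cases huv : u = v
      · subst huv; simp [huw]
      by_cases hvw : v = w
      · subst hvw; simp [huw]
      rw [if_neg huw, if_neg huv, if_neg hvw, ← ENNReal.ofReal_min,
        ← ENNReal.ofReal_add (gromovProduct_nonneg _ _ _) hδ]
      refine ENNReal.ofReal_le_ofReal ?_
      linarith [h p u.1 w.1 v.1])
  have hq : ∀ y, q (y, false) (x, true) = ENNReal.ofReal (gromovProduct p y x) := fun y =>
    if_neg (by simp)
  refine ⟨fun y => d.dist (y, false) (x, true), fun y => ?_, fun y => ?_, fun y z => ?_⟩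
  · rw [← expNeg_ofReal a (gromovProduct_nonneg p y x), ← hq]; exact (hd _ _).1
  · rw [← expNeg_ofReal a (gromovProduct_nonneg p y x), ← hq]; exact (hd _ _).2
  · have h1 := d.dist_triangle (y, false) (z, false) (x, true)
    have h2 := (hd (y, false) (z, false)).1
    have h3 : expNeg a (q (y, false) (z, false)) ≤ a ^ (-gromovProduct p y z) := by
      refine expNeg_le_rpow ha ?_
      simp only [q]
      split_ifs
      · exact le_top
      · exact le_rfl
    linarith

/-! ### The Gromov product on the boundary -/

section Boundary

variable {X : Type*} [MetricSpace X] {hX : IsGromovHyperbolic X}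

theorem boundaryProduct_le {o : X} {ξ η : GromovBoundary X hX}
    {x y : {x : ℕ → X // ConvergesToInfinity x}} (hx : Quotient.mk (boundarySetoid hX) x = ξ)
    (hy : Quotient.mk (boundarySetoid hX) y = η) :
    boundaryProduct o ξ η ≤
      liminf (fun i => ENNReal.ofReal (gromovProduct o (x.1 i) (y.1 i))) atTop :=
  iInf_le_of_le x (iInf_le_of_le y (iInf_le_of_le hx (iInf_le _ hy)))

theorem le_boundaryProduct {o : X} {ξ η : GromovBoundary X hX} {t : ℝ}
    (h : ∀ x y : {x : ℕ → X // ConvergesToInfinity x}, Quotient.mk (boundarySetoid hX) x = ξ →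
      Quotient.mk (boundarySetoid hX) y = η →
      ∀ᶠ i in atTop, t ≤ gromovProduct o (x.1 i) (y.1 i)) :
    ENNReal.ofReal t ≤ boundaryProduct o ξ η := by
  refine le_iInf fun x => le_iInf fun y => le_iInf fun hx => le_iInf fun hy => ?_
  refine le_liminf_of_le (by isBoundedDefault) ?_
  filter_upwards [h x y hx hy] with i hi
  exact ENNReal.ofReal_le_ofReal hi

theorem boundaryProduct_le_of_frequently {o : X} {ξ η : GromovBoundary X hX} {t : ℝ}
    {x y : {x : ℕ → X // ConvergesToInfinity x}} (hx : Quotient.mk (boundarySetoid hX) x = ξ)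
    (hy : Quotient.mk (boundarySetoid hX) y = η)
    (h : ∃ᶠ i in atTop, gromovProduct o (x.1 i) (y.1 i) ≤ t) :
    boundaryProduct o ξ η ≤ ENNReal.ofReal t :=
  (boundaryProduct_le hx hy).trans (liminf_le_of_frequently_le'
    (h.mono fun _ hi => ENNReal.ofReal_le_ofReal hi))

theorem eventually_of_lt_boundaryProduct {o : X} {ξ η : GromovBoundary X hX} {t : ℝ}
    (h : ENNReal.ofReal t < boundaryProduct o ξ η)
    {x y : {x : ℕ → X // ConvergesToInfinity x}} (hx : Quotient.mk (boundarySetoid hX) x = ξ)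
    (hy : Quotient.mk (boundarySetoid hX) y = η) :
    ∀ᶠ i in atTop, t ≤ gromovProduct o (x.1 i) (y.1 i) := by
  have := eventually_lt_of_lt_liminf (h.trans_le (boundaryProduct_le hx hy))
  filter_upwards [this] with i hi
  exact ((ENNReal.ofReal_lt_ofReal_iff').1 hi).1.le

theorem exists_frequently_of_boundaryProduct_lt {o : X} {ξ η : GromovBoundary X hX} {t : ℝ}
    (h : boundaryProduct o ξ η < ENNReal.ofReal t) :
    ∃ x y : {x : ℕ → X // ConvergesToInfinity x}, Quotient.mk (boundarySetoid hX) x = ξ ∧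
      Quotient.mk (boundarySetoid hX) y = η ∧
      ∃ᶠ i in atTop, gromovProduct o (x.1 i) (y.1 i) ≤ t := by
  rw [boundaryProduct, iInf_lt_iff] at h
  obtain ⟨x, h⟩ := h
  rw [iInf_lt_iff] at h
  obtain ⟨y, h⟩ := h
  rw [iInf_lt_iff] at h
  obtain ⟨hx, h⟩ := h
  rw [iInf_lt_iff] at h
  obtain ⟨hy, h⟩ := h
  refine ⟨x, y, hx, hy, (frequently_lt_of_liminf_lt (by isBoundedDefault) h).mono fun i hi => ?_⟩
  exact ((ENNReal.ofReal_lt_ofReal_iff').1 hi).1.le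

theorem mk_eq_mk_iff_tendsto {x y : {x : ℕ → X // ConvergesToInfinity x}} :
    (Quotient.mk (boundarySetoid hX) x = Quotient.mk (boundarySetoid hX) y) ↔
      ∀ o : X, Tendsto (fun i => gromovProduct o (x.1 i) (y.1 i)) atTop atTop :=
  Quotient.eq

/-- Representatives of one boundary point have large Gromov products, uniformly. -/
theorem eventually_ge_of_mk_eq {δ : ℝ} (hδ : DeltaInequality X δ)
    {x y : {x : ℕ → X // ConvergesToInfinity x}}
    (h : Quotient.mk (boundarySetoid hX) x = Quotient.mk (boundarySetoid hX) y) (o : X) (b : ℝ) :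
    ∃ N, ∀ i j, N ≤ i → N ≤ j → b ≤ gromovProduct o (x.1 i) (y.1 j) := by
  obtain ⟨N₁, h1⟩ := x.2.eventually_ge o (b + δ)
  obtain ⟨N₂, h2⟩ := eventually_atTop.1 ((tendsto_atTop.1 (mk_eq_mk_iff_tendsto.1 h o)) (b + δ))
  refine ⟨max N₁ N₂, fun i j hi hj => ?_⟩
  have := hδ.le_gromovProduct (h1 i j ((le_max_left _ _).trans hi) ((le_max_left _ _).trans hj))
    (h2 j ((le_max_right _ _).trans hj))
  linarith

theorem boundaryProduct_comm (o : X) (ξ η : GromovBoundary X hX) :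
    boundaryProduct o ξ η = boundaryProduct o η ξ := by
  rw [boundaryProduct, boundaryProduct, iInf_comm]
  refine iInf_congr fun y => iInf_congr fun x => ?_
  rw [iInf_comm]
  refine iInf_congr fun _ => iInf_congr fun _ => ?_
  simp only [gromovProduct_comm o]

theorem boundaryProduct_self (o : X) (ξ : GromovBoundary X hX) : boundaryProduct o ξ ξ = ∞ := by
  refine ENNReal.eq_top_of_forall_nnreal_le fun r => ?_
  rw [← ENNReal.ofReal_coe_nnreal]
  refine le_boundaryProduct fun x y hx hy => ?_
  exact (tendsto_atTop.1 (mk_eq_mk_iff_tendsto.1 (hx.trans hy.symm) o)) r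

theorem eq_of_boundaryProduct_eq_top {o : X} {ξ η : GromovBoundary X hX}
    (h : boundaryProduct o ξ η = ∞) : ξ = η := by
  obtain ⟨x, hx⟩ := Quotient.exists_rep ξ
  obtain ⟨y, hy⟩ := Quotient.exists_rep η
  rw [← hx, ← hy]
  refine mk_eq_mk_iff_tendsto.2 fun o' => ?_
  refine tendsto_atTop.2 fun b => ?_
  filter_upwards [eventually_of_lt_boundaryProduct (t := b + dist o o')
    (h ▸ ENNReal.ofReal_lt_top) hx hy] with i hi
  linarith [gromovProduct_le_add_dist_base o o' (x.1 i) (y.1 i)]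

/-- One representative of `η` serves for both products at the same indices, so the constant remains
`δ`. -/
theorem boundaryProduct_delta {δ : ℝ} (hδ : DeltaInequality X δ) (o : X)
    (ξ η ζ : GromovBoundary X hX) :
    min (boundaryProduct o ξ η) (boundaryProduct o η ζ) ≤
      boundaryProduct o ξ ζ + ENNReal.ofReal δ := by
  refine le_of_forall_lt fun r hr => ?_
  obtain ⟨s, hrs, hs⟩ := exists_between hr
  refine hrs.trans_le ?_
  have hst : s ≠ ∞ := hs.ne_top
  rw [← ENNReal.ofReal_toReal hst] at hs ⊢
  have key : ENNReal.ofReal (s.toReal - δ) ≤ boundaryProduct o ξ ζ := by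
    refine le_boundaryProduct fun x z hx hz => ?_
    obtain ⟨y, hy⟩ := Quotient.exists_rep η
    filter_upwards [eventually_of_lt_boundaryProduct (hs.trans_le (min_le_left _ _)) hx hy,
      eventually_of_lt_boundaryProduct (hs.trans_le (min_le_right _ _)) hy hz] with i h1 h2
    exact hδ.le_gromovProduct h1 h2
  calc ENNReal.ofReal s.toReal = ENNReal.ofReal (s.toReal - δ + δ) := by ring_nf
    _ ≤ ENNReal.ofReal (s.toReal - δ) + ENNReal.ofReal δ := ENNReal.ofReal_add_le
    _ ≤ _ := by gcongr

/-- A lower bound for the Gromov product of two boundary points, in terms of any two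
representatives. -/
theorem le_boundaryProduct_of_reps {δ : ℝ} (hδ : DeltaInequality X δ) {o : X}
    {x y : {x : ℕ → X // ConvergesToInfinity x}} {t : ℝ}
    (h : ∃ N, ∀ i j, N ≤ i → N ≤ j → t ≤ gromovProduct o (x.1 i) (y.1 j)) :
    ENNReal.ofReal (t - 2 * δ) ≤ boundaryProduct o (Quotient.mk (boundarySetoid hX) x)
      (Quotient.mk (boundarySetoid hX) y) := by
  refine le_boundaryProduct fun x' y' hx hy => ?_
  obtain ⟨N, hN⟩ := h
  obtain ⟨N₁, h1⟩ := eventually_ge_of_mk_eq hδ hx o t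
  obtain ⟨N₂, h2⟩ := eventually_ge_of_mk_eq hδ hy.symm o (t - δ)
  filter_upwards [eventually_ge_atTop N, eventually_ge_atTop N₁, eventually_ge_atTop N₂]
    with i hi hi1 hi2
  have := hδ.le_gromovProduct (hδ.le_gromovProduct (h1 i i hi1 hi1) (hN i i hi hi))
    (h2 i i hi2 hi2)
  linarith

/-- The boundary product compares equal indices only; convergence of `x` to infinity decouples them
at the cost of one `δ`. -/
theorem exists_forall_ge_of_lt_boundaryProduct {δ : ℝ} (hδ : DeltaInequality X δ)
    {o : X} {x y : {x : ℕ → X // ConvergesToInfinity x}} {t : ℝ}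
    (h : ENNReal.ofReal t < boundaryProduct o (Quotient.mk (boundarySetoid hX) x)
      (Quotient.mk (boundarySetoid hX) y)) :
    ∃ N, ∀ i j, N ≤ i → N ≤ j → t - δ ≤ gromovProduct o (x.1 i) (y.1 j) := by
  obtain ⟨N₁, h1⟩ := x.2.eventually_ge o t
  obtain ⟨N₂, h2⟩ := eventually_atTop.1 (eventually_of_lt_boundaryProduct h rfl rfl)
  refine ⟨max N₁ N₂, fun i j hi hj => ?_⟩
  exact hδ.le_gromovProduct (h1 i j ((le_max_left _ _).trans hi) ((le_max_left _ _).trans hj))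
    (h2 j ((le_max_right _ _).trans hj))

/-- The representatives that nearly attain the infimum need not be the given ones; exchanging each
of the two costs one `δ`. -/
theorem exists_forall_le_of_boundaryProduct_lt {δ : ℝ} (h0 : 0 ≤ δ) (hδ : DeltaInequality X δ)
    {o : X} {x y : {x : ℕ → X // ConvergesToInfinity x}} {t : ℝ}
    (h : boundaryProduct o (Quotient.mk (boundarySetoid hX) x)
      (Quotient.mk (boundarySetoid hX) y) < ENNReal.ofReal t) :
    ∃ N, ∀ i j, N ≤ i → N ≤ j → gromovProduct o (x.1 i) (y.1 j) ≤ t + 2 * δ := by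
  obtain ⟨x', y', hx, hy, hfr⟩ := exists_frequently_of_boundaryProduct_lt h
  obtain ⟨N₁, h1⟩ := eventually_ge_of_mk_eq hδ hx o (t + 2 * δ + 1)
  obtain ⟨N₂, h2⟩ := eventually_ge_of_mk_eq hδ hy.symm o (t + 2 * δ + 1)
  refine ⟨max N₁ N₂, fun i j hi hj => ?_⟩
  by_contra! hlt
  obtain ⟨k, hk, hle⟩ := (frequently_atTop.1 hfr) (max N₁ N₂)
  -- The minimum is a threshold above `t + 2 * δ` met by all three products along `x'`, `x`, `y`,
  -- `y'`.
  have h3 := hδ.le_gromovProduct (t := min (t + 2 * δ + 1) (gromovProduct o (x.1 i) (y.1 j)))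
    ((min_le_left _ _).trans (h1 k i ((le_max_left _ _).trans hk) ((le_max_left _ _).trans hi)))
    (min_le_right _ _)
  have h4 := hδ.le_gromovProduct h3 (z := y.1 j) (y := y'.1 k) (by
    have h5 := h2 j k ((le_max_right _ _).trans hj) ((le_max_right _ _).trans hk)
    have h6 := min_le_left (t + 2 * δ + 1) (gromovProduct o (x.1 i) (y.1 j))
    linarith)
  have h7 : t + 2 * δ < min (t + 2 * δ + 1) (gromovProduct o (x.1 i) (y.1 j)) :=
    lt_min (by linarith) hlt
  linarith

/-- Hyperbolic spaces have visual metrics, at every base point. -/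
theorem exists_visualMetric {δ a : ℝ} (h0 : 0 ≤ δ) (hδ : DeltaInequality X δ) (ha : 1 < a)
    (haδ : a ^ (2 * δ) ≤ 2) (o : X) :
    ∃ d : MetricSpace (GromovBoundary X hX), ∀ ξ η,
      d.dist ξ η ≤ expNeg a (boundaryProduct o ξ η) ∧
        expNeg a (boundaryProduct o ξ η) ≤ 2 * d.dist ξ η := by
  obtain ⟨d, hd⟩ := exists_pseudoMetric_of_delta (fun ξ η : GromovBoundary X hX =>
    boundaryProduct o ξ η) h0 ha haδ (boundaryProduct_self o) (boundaryProduct_comm o)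
    (boundaryProduct_delta hδ o)
  refine ⟨{ d with eq_of_dist_eq_zero := fun {ξ η} h => ?_ }, hd⟩
  by_contra hne
  have h1 := expNeg_pos ha (t := boundaryProduct o ξ η)
    fun h => hne (eq_of_boundaryProduct_eq_top h)
  have h2 := (hd ξ η).2
  have h3 : d.dist ξ η = 0 := h
  linarith

end Boundary

/-! ### The isoperimetric inequality -/

section Isoperimetry

variable {V : Type*} {G : SimpleGraph V}

theorem mem_vertexBoundary {A : Set V} {v : V} :
    v ∈ vertexBoundary G A ↔ v ∉ A ∧ ∃ a ∈ A, G.Adj v a := by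
  rw [vertexBoundary, mem_ofPred_eq]
  constructor
  · intro h
    have hge : ∀ a ∈ A, 1 ≤ G.edist v a := fun a ha => h ▸ iInf₂_le a ha
    refine ⟨fun hv => ?_, ?_⟩
    · have := hge v hv
      simp at this
    · by_contra! hcon
      have h2 : (2 : ℕ∞) ≤ ⨅ a ∈ A, G.edist v a := by
        refine le_iInf₂ fun a ha => ?_
        have h1 : (1 : ℕ∞) < G.edist v a := lt_of_le_of_ne (hge a ha) fun h =>
          hcon a ha (SimpleGraph.edist_eq_one_iff_adj.1 h.symm)
        exact Order.add_one_le_of_lt h1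
      rw [h] at h2
      exact absurd h2 (by decide)
  · rintro ⟨hv, a, ha, hadj⟩
    refine le_antisymm ((iInf₂_le a ha).trans (SimpleGraph.edist_eq_one_iff_adj.2 hadj).le) ?_
    refine le_iInf₂ fun b hb => ?_
    rw [Order.one_le_iff_pos]
    exact SimpleGraph.edist_pos_of_ne fun h => hv (h ▸ hb)

/-- The neighbourhoods of radius one have at most `D` vertices. -/
def HasDegreeBound (G : SimpleGraph V) (D : ℕ) : Prop :=
  2 ≤ D ∧ ∀ v : V, (insert v (G.neighborSet v)).Finite ∧ (insert v (G.neighborSet v)).ncard ≤ D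

theorem IsUniformGraph.exists_hasDegreeBound (h : IsUniformGraph G) :
    ∃ D, HasDegreeBound G D := by
  obtain ⟨μ, hμ⟩ := h
  -- `μ + 1` already bounds the closed neighbourhoods; one more ensures `2 ≤ D`, so that `D` can be
  -- a growth rate.
  refine ⟨μ + 2, by omega, fun v => ?_⟩
  have hfin : (G.neighborSet v).Finite := finite_of_encard_le_coe (hμ v)
  refine ⟨hfin.insert v, (ncard_insert_le _ _).trans ?_⟩
  have := hμ v
  rw [← hfin.cast_ncard_eq] at this
  have : (G.neighborSet v).ncard ≤ μ := by exact_mod_cast this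
  omega

theorem HasDegreeBound.finite_neighborSet {D : ℕ} (hD : HasDegreeBound G D) (v : V) :
    (G.neighborSet v).Finite :=
  (hD.2 v).1.subset (subset_insert _ _)

theorem HasDegreeBound.finite_vertexBoundary {D : ℕ} (hD : HasDegreeBound G D) (A : Finset V) :
    (vertexBoundary G (A : Set V)).Finite := by
  refine (A.finite_toSet.biUnion fun a _ => hD.finite_neighborSet a).subset fun v hv => ?_
  obtain ⟨-, a, ha, hadj⟩ := mem_vertexBoundary.1 hv
  exact mem_biUnion ha hadj.symm

/-- The isoperimetric inequality with constant `h`. -/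
def HasIsoperimetry (G : SimpleGraph V) (h : ℝ) : Prop :=
  ∀ A : Finset V, h * A.card ≤ (vertexBoundary G (A : Set V)).ncard

theorem ofReal_le_encard_div {D : ℕ} (hD : HasDegreeBound G D) {A : Finset V} (hA : A.Nonempty)
    {h : ℝ} (h0 : 0 ≤ h) :
    ENNReal.ofReal h ≤ ((vertexBoundary G (A : Set V)).encard : ℝ≥0∞) / (A.card : ℝ≥0∞) ↔
      h * A.card ≤ (vertexBoundary G (A : Set V)).ncard := by
  have hc : (A.card : ℝ≥0∞) ≠ 0 := by simpa using hA.ne_empty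
  rw [ENNReal.le_div_iff_mul_le (Or.inl hc) (Or.inl (ENNReal.natCast_ne_top _)),
    ← (hD.finite_vertexBoundary A).cast_ncard_eq, ENat.toENNReal_coe, ← ENNReal.ofReal_natCast,
    ← ENNReal.ofReal_natCast, ← ENNReal.ofReal_mul h0,
    ENNReal.ofReal_le_ofReal_iff (Nat.cast_nonneg _)]

theorem cheegerConstant_pos_iff {D : ℕ} (hD : HasDegreeBound G D) :
    0 < cheegerConstant G ↔ ∃ h : ℝ, 0 < h ∧ HasIsoperimetry G h := by
  constructor
  · intro h
    obtain ⟨r, hr0, hr⟩ := ENNReal.lt_iff_exists_real_btwn.1 h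
    have hr1 : 0 < r := ENNReal.ofReal_pos.1 hr.1
    refine ⟨r, hr1, fun A => ?_⟩
    rcases A.eq_empty_or_nonempty with rfl | hA
    · simp
    · exact (ofReal_le_encard_div hD hA hr1.le).1 (hr.2.le.trans (iInf₂_le A hA))
  · rintro ⟨h, h0, hG⟩
    refine (ENNReal.ofReal_pos.2 h0).trans_le (le_iInf₂ fun A hA => ?_)
    exact (ofReal_le_encard_div hD hA h0.le).2 (hG A)

/-- A finite `V` would itself be a test set with empty boundary. -/
theorem HasIsoperimetry.infinite [Nonempty V] {h : ℝ} (h0 : 0 < h) (hG : HasIsoperimetry G h) :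
    Infinite V := by
  by_contra hfin
  rw [not_infinite_iff_finite] at hfin
  have := Fintype.ofFinite V
  have h1 := hG Finset.univ
  have h2 : vertexBoundary G ((Finset.univ : Finset V) : Set V) = ∅ := by
    ext v; simp [mem_vertexBoundary]
  rw [h2, ncard_empty, Nat.cast_zero] at h1
  have : 0 < ((Finset.univ : Finset V).card : ℝ) := by simp [Fintype.card_pos]
  exact absurd h1 (not_le.2 (mul_pos h0 this))

/-- Growth of superlevel sets, if the function does not drop below `θ'` at the boundary outside of
an exceptional set `W`. -/
theorem HasIsoperimetry.ncard_superlevel_le {h : ℝ} (hG : HasIsoperimetry G h) {f : V → ℝ}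
    {θ θ' : ℝ} (hθ : θ' ≤ θ) (hfin : {y | θ' < f y}.Finite) {W : Set V} (hW : W.Finite)
    (hstep : ∀ y z, G.Adj y z → θ < f y → θ' < f z ∨ z ∈ W) :
    (1 + h) * {y | θ < f y}.ncard ≤ {y | θ' < f y}.ncard + W.ncard := by
  have hsub : {y | θ < f y} ⊆ {y | θ' < f y} := fun y hy => hθ.trans_lt hy
  have hA := hfin.subset hsub
  have h1 := hG hA.toFinset
  rw [← ncard_eq_toFinset_card _ hA, Finite.coe_toFinset] at h1
  -- The boundary lies in the shell between the two levels, up to `W`.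
  have h2 : vertexBoundary G {y | θ < f y} ⊆ ({y | θ' < f y} \ {y | θ < f y}) ∪ W := by
    intro z hz
    obtain ⟨hz, y, hy, hadj⟩ := mem_vertexBoundary.1 hz
    exact (hstep y z hadj.symm hy).imp (fun h => ⟨h, hz⟩) id
  have h3 := (ncard_le_ncard h2 (hfin.sdiff.union hW)).trans (ncard_union_le _ _)
  have h4 := ncard_sdiff_add_ncard_of_subset hsub hfin
  have h5 : ((vertexBoundary G {y | θ < f y}).ncard : ℝ) ≤
      ({y | θ' < f y} \ {y | θ < f y}).ncard + W.ncard := by exact_mod_cast h3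
  have h6 : (({y | θ' < f y} \ {y | θ < f y}).ncard : ℝ) + {y | θ < f y}.ncard =
      {y | θ' < f y}.ncard := by exact_mod_cast h4
  linarith

end Isoperimetry

/-! ### Blow-up in finite time -/

/-- A function which grows by a definite factor over intervals of length `κ a ^ (-L)`, up to an
error of order `D ^ L` for each `L`, is infinite after finite time as soon as it is large. -/
theorem exists_bound_of_growth {h a κ D : ℝ} (hh : 0 < h) (ha : 1 < a) (hκ : 0 ≤ κ) (hD : 2 ≤ D) :
    ∃ C : ℝ, 0 < C ∧ ∀ (E B : ℝ) (N : ℝ → ℝ), 0 < E →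
      (∀ θ θ', 1 / 2 ≤ θ' → θ' ≤ θ → θ ≤ 1 → N θ ≤ N θ') →
      (∀ θ, 1 / 2 ≤ θ → θ ≤ 1 → N θ ≤ B) →
      (∀ θ (L : ℕ), θ ≤ 1 → 1 / 2 ≤ θ - κ * (1 / a) ^ L →
        (1 + h) * N θ ≤ N (θ - κ * (1 / a) ^ L) + E * D ^ L) →
      N 1 ≤ C * E := by
  -- While the error is at most `h / 2 * N θ`, each step still multiplies `N` by `b`; `s` steps then
  -- gain more than the factor `D` by which the error grows from `L` to `L + 1`.
  set b : ℝ := 1 + h / 2 with hb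
  have hb1 : 1 < b := by rw [hb]; linarith
  obtain ⟨s, hs⟩ := pow_unbounded_of_one_lt D hb1
  set x : ℝ := 1 / a with hx
  have hx0 : 0 < x := by positivity
  have hx1 : x < 1 := (div_lt_one (by linarith)).2 ha
  -- `s` steps at scale `L₀ + j` use at most `(1 - x) / 2 * x ^ j`, exactly the gap between `1 / 2 +
  -- 1 / 2 * x ^ j` and the next such level. All stages together stay above `1 / 2`.
  obtain ⟨L₀, hL₀⟩ := exists_pow_lt_of_lt_one (show 0 < (1 - x) / (2 * (s * κ + 1)) from
    div_pos (by linarith) (by positivity)) hx1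
  have hL : s * κ * x ^ L₀ ≤ (1 - x) / 2 := by
    rw [lt_div_iff₀ (by positivity)] at hL₀
    nlinarith [pow_pos hx0 L₀]
  have hbs : ∀ i : ℕ, 1 ≤ b ^ i := fun i => one_le_pow₀ hb1.le
  refine ⟨2 / h * D ^ L₀, by positivity, fun E B N hE hanti hB hstep => ?_⟩
  by_contra! hlarge
  have hN1 : 0 < N 1 := lt_of_le_of_lt (by positivity) hlarge
  have hlarge' : E * D ^ L₀ ≤ h / 2 * N 1 := by
    have : h / 2 * (2 / h * D ^ L₀ * E) = E * D ^ L₀ := by field_simp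
    rw [← this]
    exact mul_le_mul_of_nonneg_left hlarge.le (by positivity)
  have block : ∀ (L : ℕ) (θ : ℝ), θ ≤ 1 → 0 ≤ N θ → E * D ^ L ≤ h / 2 * N θ → ∀ i : ℕ,
      1 / 2 ≤ θ - i * (κ * x ^ L) → b ^ i * N θ ≤ N (θ - i * (κ * x ^ L)) := by
    intro L θ hθ hN hE' i
    induction i with
    | zero => simp
    | succ i ih =>
      intro hi
      have hpos : 0 ≤ κ * x ^ L := by positivity
      have e : θ - ((i + 1 : ℕ) : ℝ) * (κ * x ^ L) = θ - i * (κ * x ^ L) - κ * x ^ L := by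
        push_cast; ring
      rw [e] at hi ⊢
      have h1 := ih (by linarith)
      have h2 := hstep (θ - i * (κ * x ^ L)) L
        (by have : 0 ≤ (i : ℝ) * (κ * x ^ L) := by positivity
            linarith) hi
      have h3 : N θ ≤ N (θ - i * (κ * x ^ L)) := le_trans (le_mul_of_one_le_left hN (hbs i)) h1
      have h4 : E * D ^ L ≤ h / 2 * N (θ - i * (κ * x ^ L)) :=
        hE'.trans (mul_le_mul_of_nonneg_left h3 (by positivity))
      calc b ^ (i + 1) * N θ = b * (b ^ i * N θ) := by ring
        _ ≤ b * N (θ - i * (κ * x ^ L)) := mul_le_mul_of_nonneg_left h1 (by linarith)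
        _ = (1 + h) * N (θ - i * (κ * x ^ L)) - h / 2 * N (θ - i * (κ * x ^ L)) := by
          rw [hb]; ring
        _ ≤ _ := by linarith
  have hx1' : ∀ j : ℕ, x ^ j ≤ 1 := fun j => pow_le_one₀ hx0.le hx1.le
  -- Stage `j` works at scale `L₀ + j`: both `N` and the error have gained `D ^ j`, so the error
  -- remains negligible. The bound `B` is eventually exceeded.
  have hgrow : ∀ j : ℕ, D ^ j * N 1 ≤ N (1 / 2 + 1 / 2 * x ^ j) := by
    intro j
    induction j with
    | zero => norm_num
    | succ j ih =>
      have hNj : 0 ≤ N (1 / 2 + 1 / 2 * x ^ j) := le_trans (by positivity) ih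
      have hj : E * D ^ (L₀ + j) ≤ h / 2 * N (1 / 2 + 1 / 2 * x ^ j) := by
        calc E * D ^ (L₀ + j) = D ^ j * (E * D ^ L₀) := by rw [pow_add]; ring
          _ ≤ D ^ j * (h / 2 * N 1) := mul_le_mul_of_nonneg_left hlarge' (by positivity)
          _ = h / 2 * (D ^ j * N 1) := by ring
          _ ≤ _ := mul_le_mul_of_nonneg_left ih (by positivity)
      have hdrop : (s : ℝ) * (κ * x ^ (L₀ + j)) ≤ (1 - x) / 2 * x ^ j := by
        calc (s : ℝ) * (κ * x ^ (L₀ + j)) = s * κ * x ^ L₀ * x ^ j := by rw [pow_add]; ring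
          _ ≤ _ := mul_le_mul_of_nonneg_right hL (by positivity)
      have hle : 1 / 2 + 1 / 2 * x ^ (j + 1) ≤
          1 / 2 + 1 / 2 * x ^ j - s * (κ * x ^ (L₀ + j)) := by
        rw [pow_succ]; linarith
      have hhalf : 1 / 2 ≤ 1 / 2 + 1 / 2 * x ^ (j + 1) := by
        have : 0 < x ^ (j + 1) := by positivity
        linarith
      have h1 := block (L₀ + j) (1 / 2 + 1 / 2 * x ^ j) (by linarith [hx1' j]) hNj hj s
        (hhalf.trans hle)
      have h2 := hanti (1 / 2 + 1 / 2 * x ^ j - s * (κ * x ^ (L₀ + j))) _ hhalf hle (by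
        have : 0 ≤ (s : ℝ) * (κ * x ^ (L₀ + j)) := by positivity
        linarith [hx1' j])
      calc D ^ (j + 1) * N 1 = D * (D ^ j * N 1) := by ring
        _ ≤ D * N (1 / 2 + 1 / 2 * x ^ j) := mul_le_mul_of_nonneg_left ih (by linarith)
        _ ≤ b ^ s * N (1 / 2 + 1 / 2 * x ^ j) := mul_le_mul_of_nonneg_right hs.le hNj
        _ ≤ _ := h1.trans h2
  obtain ⟨j, hj⟩ := pow_unbounded_of_one_lt (B / N 1) (show 1 < D by linarith)
  have h1 := hgrow j
  have h2 := hB (1 / 2 + 1 / 2 * x ^ j)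
    (by have : 0 < x ^ j := by positivity
        linarith) (by linarith [hx1' j])
  rw [div_lt_iff₀ hN1] at hj
  linarith

/-- Lets the exponential initial growth beat the exceptional vertices, whose number is linear in
`k`. -/
theorem exists_linear_lt_pow {r : ℝ} (hr : 1 < r) (K : ℝ) : ∃ k : ℕ, K * (k + 1) < r ^ k := by
  have h1 := (tendsto_pow_const_div_const_pow_of_one_lt 1 hr).const_mul (|K| + 1)
  have h2 := (tendsto_pow_const_div_const_pow_of_one_lt 0 hr).const_mul (|K| + 1)
  have h3 := h1.add h2
  simp only [mul_zero, add_zero] at h3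
  obtain ⟨k, hk⟩ := (h3.eventually (gt_mem_nhds one_pos)).exists
  refine ⟨k, ?_⟩
  have hrk : 0 < r ^ k := pow_pos (by linarith) k
  have e : (|K| + 1) * ((k : ℝ) ^ 1 / r ^ k) + (|K| + 1) * ((k : ℝ) ^ 0 / r ^ k) =
      (|K| + 1) * (k + 1) / r ^ k := by simp only [pow_one, pow_zero]; ring
  rw [e, div_lt_one hrk] at hk
  have : K * (k + 1) ≤ (|K| + 1) * (k + 1) :=
    mul_le_mul_of_nonneg_right (by linarith [le_abs_self K]) (by positivity)
  linarith

/-! ### Many directions at every vertex -/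

section Directions

open MetricGraph

variable {V : Type*} {G : SimpleGraph V} {hG : G.Connected}

/-- Makes a slowly varying function change by at most `a ^ (1 - d(y, p))` along the edge. -/
theorem gromovProduct_vertex_ge_of_adj (p : V) {y z : V} (h : G.Adj y z) :
    (G.dist y p : ℝ) - 1 ≤ gromovProduct (vertex hG p) (vertex hG y) (vertex hG z) := by
  have h1 : (G.dist y z : ℝ) = 1 := by rw [SimpleGraph.dist_eq_one_iff_adj.2 h]; simp
  have h2 : (G.dist y p : ℝ) ≤ G.dist y z + G.dist z p := by exact_mod_cast hG.dist_triangle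
  rw [gromovProduct, dist_vertex, dist_vertex, dist_vertex, h1]
  linarith

/-- A vertex close to the end of its common part with a geodesic `[p, x]` is close to the initial
part of this geodesic: such vertices, and their neighbours, are few. -/
theorem ncard_near_geodesic_le {δ : ℝ} (hδ : DeltaInequality (MetricGraph G hG) δ)
    {D : ℕ} (hD : HasDegreeBound G D) {c : ℕ} (hc : 2 * δ + 2 ≤ c) (p x : V) (T L : ℕ) :
    {z | ∃ y, G.Adj y z ∧ gromovProduct (vertex hG p) (vertex hG y) (vertex hG x) ≤ T ∧
      (G.dist y p : ℝ) ≤ gromovProduct (vertex hG p) (vertex hG y) (vertex hG x) + L}.Finite ∧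
    {z | ∃ y, G.Adj y z ∧ gromovProduct (vertex hG p) (vertex hG y) (vertex hG x) ≤ T ∧
      (G.dist y p : ℝ) ≤ gromovProduct (vertex hG p) (vertex hG y) (vertex hG x) + L}.ncard ≤
        (T + 1) * D ^ (L + c) := by
  classical
  have hgeo : ∀ j : ℕ, ∃ w, j ≤ G.dist p x → G.dist p w = j ∧ j + G.dist w x = G.dist p x := by
    intro j
    by_cases hj : j ≤ G.dist p x
    · obtain ⟨w, hw⟩ := hG.exists_dist_eq p x hj
      exact ⟨w, fun _ => hw⟩
    · exact ⟨p, fun h => absurd h hj⟩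
  choose g hg using hgeo
  have hball := fun j => hG.distBall_finite_ncard_le hD.2 (g j) (L + c)
  set U : Finset V := (Finset.range (T + 1)).biUnion fun j => (hball j).1.toFinset with hU
  have hUcard : U.card ≤ (T + 1) * D ^ (L + c) := by
    refine (Finset.card_biUnion_le_card_mul _ _ (D ^ (L + c)) fun j _ => ?_).trans
      (by rw [Finset.card_range])
    rw [← ncard_eq_toFinset_card _ (hball j).1]
    exact (hball j).2
  have hsub : {z | ∃ y, G.Adj y z ∧ gromovProduct (vertex hG p) (vertex hG y) (vertex hG x) ≤ T ∧
      (G.dist y p : ℝ) ≤ gromovProduct (vertex hG p) (vertex hG y) (vertex hG x) + L} ⊆ U := by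
    rintro z ⟨y, hadj, hT, hL⟩
    set m := gromovProduct (vertex hG p) (vertex hG y) (vertex hG x) with hm
    have hm0 : 0 ≤ m := gromovProduct_nonneg _ _ _
    have hfl : (⌊m⌋₊ : ℝ) ≤ m := Nat.floor_le hm0
    have hfl' : m < ⌊m⌋₊ + 1 := Nat.lt_floor_add_one m
    have hmx : m ≤ G.dist p x := by
      have := gromovProduct_le_dist (vertex hG p) (vertex hG x) (vertex hG y)
      rw [gromovProduct_comm, dist_comm, dist_vertex] at this
      exact this
    obtain ⟨h1, h2⟩ := hg ⌊m⌋₊ (by exact_mod_cast hfl.trans hmx)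
    set w := g ⌊m⌋₊
    have h1' : (G.dist p w : ℝ) = ⌊m⌋₊ := by exact_mod_cast h1
    have h2' : (⌊m⌋₊ : ℝ) + G.dist w x = G.dist p x := by exact_mod_cast h2
    have hxw : (⌊m⌋₊ : ℝ) ≤ gromovProduct (vertex hG p) (vertex hG x) (vertex hG w) := by
      rw [gromovProduct, dist_vertex, dist_vertex, dist_vertex, G.dist_comm (u := x),
        G.dist_comm (u := w), G.dist_comm (u := x)]
      linarith
    -- From `(y|w)_p ≥ ⌊m⌋ - δ` follows `d(y, w) < L + 1 + 2δ`; the edge to `z` adds one, whence `2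
    -- * δ + 2 ≤ c`.
    have hyw := hδ.le_gromovProduct (hfl.trans hm.le) hxw
    rw [gromovProduct, dist_vertex, dist_vertex, dist_vertex, G.dist_comm (u := w)] at hyw
    have hyz : (G.dist y z : ℝ) = 1 := by rw [SimpleGraph.dist_eq_one_iff_adj.2 hadj]; simp
    have htri : (G.dist w z : ℝ) ≤ G.dist w y + G.dist y z := by exact_mod_cast hG.dist_triangle
    rw [G.dist_comm (u := w) (v := y)] at htri
    simp only [hU, Finset.coe_biUnion, mem_iUnion, Finite.coe_toFinset, Finset.coe_range,
      mem_Iio]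
    refine ⟨⌊m⌋₊, Nat.lt_succ_of_le (by exact_mod_cast hfl.trans hT), ?_⟩
    rw [SimpleGraph.mem_distBall]
    have : (G.dist w z : ℝ) ≤ ((L + c : ℕ) : ℝ) := by push_cast; linarith
    exact_mod_cast this
  refine ⟨U.finite_toSet.subset hsub, (ncard_le_ncard hsub U.finite_toSet).trans ?_⟩
  rw [ncard_coe_finset]
  exact hUcard

/-- Let `F` be slowly varying functions comparable with `a ^ (-(y|x)_p)`, for two vertices `x`. The
superlevel set of their minimum is infinite at some level which does not depend on `p` and `x`. -/
theorem superlevel_infinite_of_growth {δ a h : ℝ}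
    (hδ : DeltaInequality (MetricGraph G hG) δ) (ha : 1 < a)
    {D : ℕ} (hD : HasDegreeBound G D) {c : ℕ} (hc : 2 * δ + 2 ≤ c) (hh : 0 < h)
    (hiso : HasIsoperimetry G h) :
    ∃ θ₀ : ℝ, 0 < θ₀ ∧ ∀ (p x₁ x₂ : V) (F : Bool → V → ℝ),
      (∀ i y, F i y ≤ a ^ (-gromovProduct (vertex hG p) (vertex hG y) (vertex hG (cond i x₁ x₂)))) →
      (∀ i y, a ^ (-gromovProduct (vertex hG p) (vertex hG y) (vertex hG (cond i x₁ x₂))) ≤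
        2 * F i y) →
      (∀ i y z, F i y ≤ F i z + a ^ (-gromovProduct (vertex hG p) (vertex hG y) (vertex hG z))) →
      {y | θ₀ < min (F true y) (F false y)}.Infinite := by
  have ha0 : 0 < a := by linarith
  have hD2 : (2 : ℝ) ≤ D := by exact_mod_cast hD.1
  obtain ⟨C, hC, hblow⟩ := exists_bound_of_growth hh ha (κ := 2 * a) (by positivity) hD2
  -- With `T = s * (k + 1)` this yields `a ^ (-T) ≤ θs / 2 = 1 / (8 * (2 * a) ^ k)`, so the vertices
  -- considered have `(y|xᵢ)_p ≤ T`. The exceptional sets are then linear in `k`, and `k` depends on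
  -- neither `p` nor `x₁`, `x₂`.
  obtain ⟨s, hs⟩ := pow_unbounded_of_one_lt (max (2 * a) 8) ha
  obtain ⟨k, hk⟩ := exists_linear_lt_pow (show 1 < 1 + h by linarith)
    (C * (2 * (s + 1) * (D : ℝ) ^ c))
  set θs : ℝ := 1 / 4 * (1 / (2 * a)) ^ k with hθs
  have hθs0 : 0 < θs := by positivity
  refine ⟨θs * (1 / 2), by positivity, fun p x₁ x₂ F hup hlow hvar hfin => ?_⟩
  set x : Bool → V := fun i => cond i x₁ x₂
  set m : Bool → V → ℝ := fun i y => gromovProduct (vertex hG p) (vertex hG y) (vertex hG (x i))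
    with hm
  set f : V → ℝ := fun y => min (F true y) (F false y) with hf
  have hF0 : ∀ i y, 0 < F i y := fun i y => by
    have h1 := hlow i y
    have h2 : 0 < a ^ (-m i y) := by positivity
    linarith
  have lt_f : ∀ θ y, θ < f y ↔ ∀ i, θ < F i y := by
    intro θ y
    rw [hf, lt_min_iff, Bool.forall_bool, and_comm]
  have hfinite : ∀ θ, θs * (1 / 2) ≤ θ → {y | θ < f y}.Finite := fun θ hθ =>
    hfin.subset fun y hy => hθ.trans_lt hy
  -- exponential growth
  have hexp : ∀ j : ℕ, j ≤ k → (1 + h) ^ j ≤ {y | 1 / 4 * (1 / (2 * a)) ^ j < f y}.ncard := by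
    intro j
    induction j with
    | zero =>
      intro _
      have hp : p ∈ {y | 1 / 4 * (1 / (2 * a)) ^ 0 < f y} := by
        refine (lt_f _ _).2 fun i => ?_
        have h2 : m i p = 0 := by
          rw [hm]; simp only [gromovProduct, dist_self, dist_comm (vertex hG p)]; ring
        have h3 : a ^ (-m i p) = 1 := by rw [h2]; simp
        have h1 : a ^ (-m i p) ≤ 2 * F i p := hlow i p
        rw [pow_zero]; linarith
      have : 0 < {y | 1 / 4 * (1 / (2 * a)) ^ 0 < f y}.ncard := by
        refine (ncard_pos (hfinite _ ?_)).2 ⟨p, hp⟩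
        have : (1 / (2 * a)) ^ k ≤ 1 := pow_le_one₀ (by positivity)
          ((div_le_one (by positivity)).2 (by linarith))
        rw [pow_zero, hθs]; linarith
      rw [pow_zero]
      exact_mod_cast this
    | succ j ih =>
      intro hj
      have hle : (1 / (2 * a)) ^ (j + 1) ≤ (1 / (2 * a)) ^ j :=
        pow_le_pow_of_le_one (by positivity) ((div_le_one (by positivity)).2 (by linarith))
          (Nat.le_succ j)
      have hle' : (1 / (2 * a)) ^ k ≤ (1 / (2 * a)) ^ (j + 1) :=
        pow_le_pow_of_le_one (by positivity) ((div_le_one (by positivity)).2 (by linarith)) hj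
      have := hiso.ncard_superlevel_le (f := f) (θ := 1 / 4 * (1 / (2 * a)) ^ j)
        (θ' := 1 / 4 * (1 / (2 * a)) ^ (j + 1)) (by linarith)
        (hfinite _ (by
          rw [hθs]
          have : 0 < (1 / (2 * a)) ^ k := by positivity
          linarith)) (W := ∅) finite_empty (fun y z hadj hy => Or.inl ?_)
      · rw [ncard_empty, Nat.cast_zero, add_zero] at this
        refine le_trans ?_ this
        rw [pow_succ, mul_comm]
        exact mul_le_mul_of_nonneg_left (ih (by omega)) (by linarith)
      -- Crude step: the product changes by at most `1` along an edge, and the comparison of `F`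
      -- with the exponential costs a factor `2`, so `F` drops at most by the factor `2 * a`.
      · refine (lt_f _ _).2 fun i => ?_
        have h1 := (lt_f _ _).1 hy i
        have hyz : dist (vertex hG z) (vertex hG y) = 1 := by
          rw [dist_vertex, SimpleGraph.dist_eq_one_iff_adj.2 hadj.symm]; simp
        have h2 : m i z ≤ m i y + 1 := by
          rw [← hyz]; exact gromovProduct_le_add_dist_left _ _ _ _
        have h3 : a ^ (-m i y) * a⁻¹ ≤ a ^ (-m i z) := by
          rw [← Real.rpow_neg_one, ← Real.rpow_add ha0]
          exact Real.rpow_le_rpow_of_exponent_le ha.le (by linarith)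
        have h4 : F i y * a⁻¹ ≤ 2 * F i z :=
          ((mul_le_mul_of_nonneg_right (hup i y) (by positivity)).trans h3).trans (hlow i z)
        have h5 : 1 / 4 * (1 / (2 * a)) ^ (j + 1) = 1 / 4 * (1 / (2 * a)) ^ j * a⁻¹ / 2 := by
          rw [pow_succ]; field_simp
        have h6 : 1 / 4 * (1 / (2 * a)) ^ j * a⁻¹ < F i y * a⁻¹ :=
          mul_lt_mul_of_pos_right h1 (by positivity)
        rw [h5]; linarith
  -- the exceptional sets
  set T : ℕ := s * (k + 1) with hT
  have hTθ : a ^ (-(T : ℝ)) ≤ θs * (1 / 2) := by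
    have h1 : 2 * a ≤ a ^ s := (le_max_left _ _).trans hs.le
    have h2 : 8 ≤ a ^ s := (le_max_right _ _).trans hs.le
    rw [Real.rpow_neg ha0.le, Real.rpow_natCast, hT, pow_mul, pow_succ, hθs, one_div_pow]
    have h3 : (2 * a) ^ k ≤ (a ^ s) ^ k := pow_le_pow_left₀ (by positivity) h1 k
    have h4 : (2 * a) ^ k * 8 ≤ (a ^ s) ^ k * a ^ s := mul_le_mul h3 h2 (by norm_num) (by positivity)
    calc ((a ^ s) ^ k * a ^ s)⁻¹ ≤ ((2 * a) ^ k * 8)⁻¹ := inv_anti₀ (by positivity) h4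
      _ = _ := by rw [mul_inv]; ring
  let W : Bool → ℕ → Set V := fun i L => {z | ∃ y, G.Adj y z ∧
    gromovProduct (vertex hG p) (vertex hG y) (vertex hG (x i)) ≤ T ∧
      (G.dist y p : ℝ) ≤ gromovProduct (vertex hG p) (vertex hG y) (vertex hG (x i)) + L}
  have hW : ∀ i L, (W i L).Finite ∧ (W i L).ncard ≤ (T + 1) * D ^ (L + c) := fun i L =>
    ncard_near_geodesic_le hδ hD hc p (x i) T L
  have hWcard : ∀ L, ((W true L ∪ W false L).ncard : ℝ) ≤
      2 * (T + 1) * (D : ℝ) ^ c * (D : ℝ) ^ L := by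
    intro L
    have h1 := ncard_union_le (W true L) (W false L)
    have h2 := (hW true L).2
    have h3 := (hW false L).2
    have h4 : (W true L ∪ W false L).ncard ≤ 2 * ((T + 1) * D ^ (L + c)) := by omega
    have h5 : ((W true L ∪ W false L).ncard : ℝ) ≤ 2 * ((T + 1) * (D : ℝ) ^ (L + c)) := by
      exact_mod_cast h4
    rw [pow_add] at h5
    linarith
  -- growth in finite time
  have hE : (0 : ℝ) < 2 * (T + 1) * (D : ℝ) ^ c := by positivity
  have hfinal := hblow (2 * (T + 1) * (D : ℝ) ^ c) ({y | θs * (1 / 2) < f y}.ncard)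
    (fun θ => ({y | θs * θ < f y}.ncard : ℝ)) hE
    (fun θ θ' h1 h2 _ => by
      refine Nat.cast_le.2 (ncard_le_ncard (fun y (hy : θs * θ < f y) =>
        show θs * θ' < f y from lt_of_le_of_lt ?_ hy) (hfinite _ ?_))
      · exact mul_le_mul_of_nonneg_left h2 hθs0.le
      · exact mul_le_mul_of_nonneg_left h1 hθs0.le)
    (fun θ h1 _ => by
      refine Nat.cast_le.2 (ncard_le_ncard (fun y (hy : θs * θ < f y) =>
        show θs * (1 / 2) < f y from lt_of_le_of_lt ?_ hy) hfin)
      exact mul_le_mul_of_nonneg_left h1 hθs0.le)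
    (fun θ L h1 h2 => by
      have hxL : 0 ≤ 2 * a * (1 / a) ^ L := by positivity
      have := hiso.ncard_superlevel_le (f := f) (θ := θs * θ)
        (θ' := θs * (θ - 2 * a * (1 / a) ^ L))
        (mul_le_mul_of_nonneg_left (by linarith) hθs0.le)
        (hfinite _ (mul_le_mul_of_nonneg_left h2 hθs0.le))
        ((hW true L).1.union (hW false L).1) (fun y z hadj hy => ?_)
      · exact this.trans (by linarith [hWcard L])
      -- If `y` is within `L` of its branching height for some `i`, then `z` is exceptional.
      -- Otherwise the drop `a ^ (1 - d(y, p))` is at most `2 * a * (1 / a) ^ L` times `F i y`, a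
      -- relative loss that `θ ≤ 1` turns into the required absolute one.
      by_cases hlowy : ∃ i, (G.dist y p : ℝ) ≤ m i y + L
      · obtain ⟨i, hi⟩ := hlowy
        have hmT : m i y ≤ T := by
          have h3 := ((lt_f _ _).1 hy i).trans_le (hup i y)
          have h4 : a ^ (-(T : ℝ)) ≤ θs * θ :=
            hTθ.trans (mul_le_mul_of_nonneg_left (by linarith) hθs0.le)
          have h5 : a ^ (-(T : ℝ)) < a ^ (-m i y) := h4.trans_lt h3
          rw [Real.rpow_lt_rpow_left_iff ha] at h5
          linarith
        right
        cases i
        · exact Or.inr ⟨y, hadj, hmT, hi⟩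
        · exact Or.inl ⟨y, hadj, hmT, hi⟩
      · push Not at hlowy
        left
        refine (lt_f _ _).2 fun i => ?_
        have h3 := (lt_f _ _).1 hy i
        have h4 := gromovProduct_vertex_ge_of_adj (hG := hG) p hadj
        have h5 : a ^ (-gromovProduct (vertex hG p) (vertex hG y) (vertex hG z)) ≤
            2 * a * (1 / a) ^ L * F i y := by
          calc a ^ (-gromovProduct (vertex hG p) (vertex hG y) (vertex hG z))
              ≤ a ^ (1 + -(L : ℝ) + -m i y) :=
                Real.rpow_le_rpow_of_exponent_le ha.le (by linarith [hlowy i])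
            _ = a * (1 / a) ^ L * a ^ (-m i y) := by
                rw [Real.rpow_add ha0, Real.rpow_add ha0, Real.rpow_one, Real.rpow_neg ha0.le,
                  Real.rpow_natCast, one_div, inv_pow]
            _ ≤ a * (1 / a) ^ L * (2 * F i y) :=
                mul_le_mul_of_nonneg_left (hlow i y) (by positivity)
            _ = _ := by ring
        have h6 := hvar i y z
        have h7 : 2 * a * (1 / a) ^ L ≤ 1 := by linarith
        have h8 : θs * θ * (1 - 2 * a * (1 / a) ^ L) ≤ F i y * (1 - 2 * a * (1 / a) ^ L) :=
          mul_le_mul_of_nonneg_right h3.le (by linarith)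
        have h9 : F i y * (1 - 2 * a * (1 / a) ^ L) ≤ F i z := by linarith
        have h10 : θs * (θ - 2 * a * (1 / a) ^ L) ≤ θs * θ * (1 - 2 * a * (1 / a) ^ L) := by
          have : 0 ≤ θs * ((1 - θ) * (2 * a * (1 / a) ^ L)) :=
            mul_nonneg hθs0.le (mul_nonneg (by linarith) hxL)
          linarith
        have h11 : θs * (θ - 2 * a * (1 / a) ^ L) < F i z := by
          rcases h7.lt_or_eq with h | h
          · have : θs * θ * (1 - 2 * a * (1 / a) ^ L) < F i y * (1 - 2 * a * (1 / a) ^ L) :=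
              mul_lt_mul_of_pos_right h3 (by linarith)
            linarith
          · rw [h] at h2; linarith
        exact h11)
  have h1 := hexp k le_rfl
  simp only [mul_one] at hfinal
  -- Blow-up bounds the count at `θs` by a multiple of `k + 1`, but it is at least `(1 + h) ^ k`.
  have h2 : 2 * ((T : ℝ) + 1) * (D : ℝ) ^ c ≤ 2 * (s + 1) * (D : ℝ) ^ c * (k + 1) := by
    have : (T : ℝ) + 1 ≤ (s + 1) * (k + 1) := by
      rw [hT]; push_cast
      have : (0 : ℝ) ≤ k := Nat.cast_nonneg k
      linarith
    have h3 : (0 : ℝ) ≤ (D : ℝ) ^ c := by positivity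
    nlinarith
  have h3 := mul_le_mul_of_nonneg_left h2 hC.le
  linarith

/-- In a hyperbolic graph with positive Cheeger constant, infinitely many vertices are seen from
`p` away from the directions of `x₁` and `x₂`, uniformly. -/
theorem exists_infinite_directions {δ h : ℝ} (h0 : 0 ≤ δ)
    (hδ : DeltaInequality (MetricGraph G hG) δ)
    {D : ℕ} (hD : HasDegreeBound G D) (hh : 0 < h) (hiso : HasIsoperimetry G h) :
    ∃ t : ℝ, 0 ≤ t ∧ ∀ p x₁ x₂ : V,
      {y | gromovProduct (vertex hG p) (vertex hG y) (vertex hG x₁) ≤ t ∧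
        gromovProduct (vertex hG p) (vertex hG y) (vertex hG x₂) ≤ t}.Infinite := by
  obtain ⟨a, ha, haδ⟩ := exists_base_rpow_le_two h0
  obtain ⟨c, hc⟩ := exists_nat_ge (2 * δ + 2)
  obtain ⟨θ₀, hθ₀, H⟩ := superlevel_infinite_of_growth hδ ha hD hc hh hiso
  obtain ⟨k, hk⟩ := exists_pow_lt_of_lt_one hθ₀ ((div_lt_one (by linarith)).2 ha : 1 / a < 1)
  refine ⟨k, Nat.cast_nonneg k, fun p x₁ x₂ => ?_⟩
  choose F h1 h2 h3 using fun x => hδ.exists_slowly_varying h0 ha haδ (vertex hG p) x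
  refine (H p x₁ x₂ (fun i y => F (vertex hG (cond i x₁ x₂)) (vertex hG y))
    (fun i y => h1 _ _) (fun i y => h2 _ _) (fun i y z => h3 _ _ _)).mono fun y hy => ?_
  have key : ∀ x : V, θ₀ < F (vertex hG x) (vertex hG y) →
      gromovProduct (vertex hG p) (vertex hG y) (vertex hG x) ≤ k := by
    intro x hx
    have h4 := (hk.trans hx).trans_le (h1 (vertex hG x) (vertex hG y))
    rw [one_div, inv_pow, ← Real.rpow_natCast, ← Real.rpow_neg (by linarith),
      Real.rpow_lt_rpow_left_iff ha] at h4
    linarith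
  exact ⟨key x₁ (lt_min_iff.1 hy).1, key x₂ (lt_min_iff.1 hy).2⟩

end Directions

/-! ### Graphs with positive Cheeger constant -/

section Forward

open MetricGraph

variable {V : Type*} {G : SimpleGraph V} {hG : G.Connected}

theorem gromovProduct_vertex (hG : G.Connected) (o x y : V) :
    gromovProduct (vertex hG o) (vertex hG x) (vertex hG y) =
      ((G.dist o x : ℝ) + G.dist o y - G.dist x y) / 2 := by
  rw [gromovProduct, dist_vertex, dist_vertex, dist_vertex, G.dist_comm (v := o),
    G.dist_comm (u := y)]

/-- If `w` lies on a geodesic from `o` to `y`, then `(w|y)_o = d(o, w)`. -/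
theorem gromovProduct_vertex_of_between {o w y : V} (h : G.dist o y = G.dist o w + G.dist w y) :
    gromovProduct (vertex hG o) (vertex hG w) (vertex hG y) = G.dist o w := by
  rw [gromovProduct_vertex, h]; push_cast; ring

theorem dist_ray {f : ℕ → V} (hG : G.Connected) (hf : ∀ n, G.Adj (f n) (f (n + 1)))
    (hd : ∀ n, G.dist (f 0) (f n) = n) {m n : ℕ} (h : m ≤ n) : (G.dist (f m) (f n) : ℝ) = n - m := by
  refine le_antisymm (hG.dist_path_le f hf m n h) ?_
  have h1 : G.dist (f 0) (f n) ≤ G.dist (f 0) (f m) + G.dist (f m) (f n) := hG.dist_triangle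
  rw [hd, hd] at h1
  have h2 : (n : ℝ) ≤ m + G.dist (f m) (f n) := by exact_mod_cast h1
  linarith

/-- Geodesic rays converge to infinity. -/
theorem gromovProduct_ray {f : ℕ → V} (hG : G.Connected) (hf : ∀ n, G.Adj (f n) (f (n + 1)))
    (hd : ∀ n, G.dist (f 0) (f n) = n) {m n : ℕ} (h : m ≤ n) :
    gromovProduct (vertex hG (f 0)) (vertex hG (f m)) (vertex hG (f n)) = m := by
  rw [gromovProduct_vertex, hd, hd, dist_ray hG hf hd h]; ring

theorem convergesToInfinity_ray {f : ℕ → V} (hG : G.Connected)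
    (hf : ∀ n, G.Adj (f n) (f (n + 1))) (hd : ∀ n, G.dist (f 0) (f n) = n) :
    ConvergesToInfinity fun n => vertex hG (f n) := by
  refine ConvergesToInfinity.of_eventually_ge (vertex hG (f 0)) fun b => ?_
  obtain ⟨N, hN⟩ := exists_nat_ge b
  refine ⟨N, fun i j hi hj => ?_⟩
  rcases le_total i j with h | h
  · rw [gromovProduct_ray hG hf hd h]
    exact hN.trans (by exact_mod_cast hi)
  · rw [gromovProduct_comm, gromovProduct_ray hG hf hd h]
    exact hN.trans (by exact_mod_cast hj)

/-- If infinitely many vertices are seen from `x` in directions away from `o`, then `x` is close to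
a ray from `o`. -/
theorem exists_ray_near {δ t : ℝ} (hδ : DeltaInequality (MetricGraph G hG) δ)
    (ht : 0 ≤ t) {D : ℕ} (hD : HasDegreeBound G D) {o x : V}
    (hinf : {y | gromovProduct (vertex hG x) (vertex hG y) (vertex hG o) ≤ t}.Infinite) :
    ∃ f : ℕ → V, f 0 = o ∧ (∀ n, G.Adj (f n) (f (n + 1))) ∧ (∀ n, G.dist o (f n) = n) ∧
      (G.dist x (f (G.dist o x)) : ℝ) ≤ 2 * t + 2 * δ := by
  obtain ⟨f, hf0, hadj, hd, hZ⟩ := hG.exists_ray hD.finite_neighborSet o hinf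
  refine ⟨f, hf0, hadj, hd, ?_⟩
  obtain ⟨y, hy, hy'⟩ := (hZ (G.dist o x)).nonempty
  set w := f (G.dist o x)
  have hw : G.dist o w = G.dist o x := hd _
  have h1 : gromovProduct (vertex hG o) (vertex hG w) (vertex hG y) = G.dist o x := by
    rw [gromovProduct_vertex_of_between (by rw [hw, hy']), hw]
  -- `(y|o)_x ≤ t` gives `(x|y)_o ≥ d(o, x) - t`; as `w` is at the height of `x` on a geodesic to
  -- `y`, this forces `w` to be close to `x`.
  have h2 := gromovProduct_add_gromovProduct (vertex hG o) (vertex hG x) (vertex hG y)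
  rw [gromovProduct_comm (vertex hG x), dist_vertex] at h2
  have hy1 : gromovProduct (vertex hG x) (vertex hG y) (vertex hG o) ≤ t := hy
  have h3 := hδ.le_gromovProduct (o := vertex hG o) (x := vertex hG x) (y := vertex hG w)
    (z := vertex hG y) (t := G.dist o x - t) (by linarith)
    (by rw [gromovProduct_comm, h1]; linarith)
  rw [gromovProduct_vertex, hw] at h3
  linarith

theorem hasPole_of_directions {δ t : ℝ} (h0 : 0 ≤ δ) (hδ : DeltaInequality (MetricGraph G hG) δ)
    (ht : 0 ≤ t) {D : ℕ} (hD : HasDegreeBound G D) (o : V)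
    (hinf : ∀ x : V,
      {y | gromovProduct (vertex hG x) (vertex hG y) (vertex hG o) ≤ t}.Infinite) :
    HasPole (MetricGraph G hG) := by
  -- Of the final `2`, one pays for moving to a vertex and one makes the inequality strict.
  refine ⟨vertex hG o, 2 * t + 2 * δ + 2, by positivity, fun z => ?_⟩
  obtain ⟨x, hx⟩ := exists_dist_vertex_le z
  obtain ⟨f, hf0, hadj, hd, hfx⟩ := exists_ray_near hδ ht hD (hinf x)
  refine ⟨unitSpeedPath hG f hadj, isometry_unitSpeedPath hG f hadj (by rwa [hf0]), ?_,
    (G.dist o x : ℕ), ?_⟩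
  · have := unitSpeedPath_natCast hG f hadj 0
    rwa [Nat.cast_zero, hf0] at this
  · rw [unitSpeedPath_natCast]
    have h1 := dist_triangle z (vertex hG x) (vertex hG (f (G.dist o x)))
    rw [dist_vertex] at h1
    linarith

/-- Boundary points at a prescribed Gromov product from a given one. -/
theorem exists_boundaryProduct_between {hX : IsGromovHyperbolic (MetricGraph G hG)} {δ t : ℝ}
    (h0 : 0 ≤ δ) (hδ : DeltaInequality (MetricGraph G hG) δ)
    (ht : 0 ≤ t) {D : ℕ} (hD : HasDegreeBound G D)
    (hinf : ∀ p x₁ x₂ : V,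
      {y | gromovProduct (vertex hG p) (vertex hG y) (vertex hG x₁) ≤ t ∧
        gromovProduct (vertex hG p) (vertex hG y) (vertex hG x₂) ≤ t}.Infinite)
    (o : V) (ξ : GromovBoundary (MetricGraph G hG) hX) (n : ℕ) :
    ∃ η : GromovBoundary (MetricGraph G hG) hX,
      ENNReal.ofReal (n - t - 5 * δ) ≤ boundaryProduct (vertex hG o) ξ η ∧
        boundaryProduct (vertex hG o) ξ η ≤ ENNReal.ofReal (n + t + 2 * δ) := by
  obtain ⟨x, hx⟩ := Quotient.exists_rep ξ
  set O := vertex hG o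
  obtain ⟨N₀, hN₀⟩ := x.2.eventually_ge O (n + t + 2 * δ + 2)
  obtain ⟨z, hz⟩ := exists_dist_vertex_le (x.1 N₀)
  have hxz : ∀ i, N₀ ≤ i → n + t + 2 * δ + 1 ≤ gromovProduct O (x.1 i) (vertex hG z) := by
    intro i hi
    have h1 := hN₀ i N₀ hi le_rfl
    have h2 := gromovProduct_le_add_dist_right O (x.1 i) (x.1 N₀) (vertex hG z)
    linarith
  have hoz : (n : ℝ) ≤ G.dist o z := by
    have h1 := hxz N₀ le_rfl
    rw [gromovProduct_comm] at h1
    have h2 := gromovProduct_le_dist O (vertex hG z) (x.1 N₀)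
    rw [dist_comm, dist_vertex] at h2
    linarith
  -- Directions leaving `p` away from both `o` and `z` branch off `[o, z]` near height `n`; the ray
  -- towards them represents `η`.
  obtain ⟨p, hop, hpz⟩ := hG.exists_dist_eq o z (by exact_mod_cast hoz : n ≤ G.dist o z)
  have hop' : (G.dist o p : ℝ) = n := by exact_mod_cast hop
  obtain ⟨f, hf0, hadj, hd, hZ⟩ := hG.exists_ray hD.finite_neighborSet o (hinf p o z)
  have hd' : ∀ n, G.dist (f 0) (f n) = n := by rwa [hf0]
  -- products of the chosen directions with `z`
  have hyz : ∀ y, gromovProduct (vertex hG p) (vertex hG y) (vertex hG o) ≤ t →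
      gromovProduct (vertex hG p) (vertex hG y) (vertex hG z) ≤ t →
      n - t - δ ≤ gromovProduct O (vertex hG y) (vertex hG z) ∧
        gromovProduct O (vertex hG y) (vertex hG z) ≤ n + t := by
    intro y h1 h2
    constructor
    · have h3 := gromovProduct_add_gromovProduct O (vertex hG p) (vertex hG y)
      rw [gromovProduct_comm (vertex hG p), gromovProduct_comm O, dist_vertex, hop'] at h3
      refine hδ.le_gromovProduct (z := vertex hG p) (by linarith) ?_
      rw [gromovProduct_vertex_of_between (by rw [hop, hpz]), hop']
      linarith
    · have h3 := gromovProduct_le_add_dist_base O (vertex hG p) (vertex hG y) (vertex hG z)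
      rw [dist_vertex, hop'] at h3
      linarith
  have hray : ∀ m : ℕ, n + t + δ < m →
      n - t - 2 * δ ≤ gromovProduct O (vertex hG (f m)) (vertex hG z) ∧
        gromovProduct O (vertex hG (f m)) (vertex hG z) ≤ n + t + δ := by
    intro m hm
    obtain ⟨y, ⟨hy1, hy2⟩, hy3⟩ := (hZ m).nonempty
    obtain ⟨h1, h2⟩ := hyz y hy1 hy2
    have h3 : gromovProduct O (vertex hG (f m)) (vertex hG y) = m := by
      rw [gromovProduct_vertex_of_between (by rw [hy3, hd]), hd]
    constructor
    · have := hδ.le_gromovProduct (o := O) (x := vertex hG (f m)) (y := vertex hG z)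
        (z := vertex hG y) (t := n - t - δ) (by linarith) h1
      linarith
    · by_contra! hlt
      have := hδ (vertex hG o) (vertex hG y) (vertex hG z) (vertex hG (f m))
      rw [gromovProduct_comm _ (vertex hG y) (vertex hG (f m)), h3] at this
      have h4 := lt_min hm hlt
      linarith
  let g : {x : ℕ → MetricGraph G hG // ConvergesToInfinity x} :=
    ⟨fun m => vertex hG (f m), convergesToInfinity_ray hG hadj hd'⟩
  obtain ⟨N₁, hN₁⟩ := exists_nat_gt ((n : ℝ) + t + δ)
  have hmain : ∀ i j, max N₀ N₁ ≤ i → max N₀ N₁ ≤ j →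
      n - t - 3 * δ ≤ gromovProduct O (x.1 i) (g.1 j) ∧
        gromovProduct O (x.1 i) (g.1 j) ≤ n + t + 2 * δ := by
    intro i j hi hj
    have h1 := hxz i ((le_max_left _ _).trans hi)
    obtain ⟨h2, h3⟩ := hray j (hN₁.trans_le (by exact_mod_cast (le_max_right _ _).trans hj))
    constructor
    · have := hδ.le_gromovProduct (o := O) (x := x.1 i) (y := g.1 j)
        (z := vertex hG z) (t := n - t - 2 * δ) (by linarith) (by rwa [gromovProduct_comm])
      linarith
    · by_contra! hlt
      have h4 := hδ O (g.1 j) (vertex hG z) (x.1 i)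
      rw [gromovProduct_comm _ (g.1 j) (x.1 i)] at h4
      have h5 := lt_min hlt (show n + t + 2 * δ < gromovProduct O (x.1 i) (vertex hG z) by linarith)
      change _ ≤ gromovProduct O (vertex hG (f j)) (vertex hG z) at h4
      linarith
  -- The lower bound loses one `δ` each for `y`, the ray and the sequence `x`, and two more for
  -- arbitrary representatives.
  refine ⟨Quotient.mk _ g, ?_, ?_⟩
  · rw [← hx]
    have := le_boundaryProduct_of_reps (hX := hX) hδ (o := O) (x := x) (y := g)
      (t := n - t - 3 * δ) ⟨max N₀ N₁, fun i j hi hj => (hmain i j hi hj).1⟩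
    rwa [show (n : ℝ) - t - 3 * δ - 2 * δ = n - t - 5 * δ by ring] at this
  · refine boundaryProduct_le_of_frequently hx rfl (Eventually.frequently ?_)
    filter_upwards [eventually_ge_atTop (max N₀ N₁)] with i hi
    exact (hmain i i hi hi).2

/-- A positive Cheeger constant yields a pole and a uniformly perfect boundary. -/
theorem hasPole_and_isUniformlyPerfect (hX : IsGromovHyperbolic (MetricGraph G hG))
    {D : ℕ} (hD : HasDegreeBound G D) {h : ℝ} (hh : 0 < h) (hiso : HasIsoperimetry G h) :
    HasPole (MetricGraph G hG) ∧
      ∃ d : MetricSpace (GromovBoundary (MetricGraph G hG) hX),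
        IsVisualMetric d ∧ @IsUniformlyPerfect (GromovBoundary (MetricGraph G hG) hX) d := by
  obtain ⟨δ, h0, hδ⟩ := id hX
  replace hδ : DeltaInequality (MetricGraph G hG) δ := hδ
  obtain ⟨t, ht, hinf⟩ := exists_infinite_directions h0 hδ hD hh hiso
  obtain ⟨o⟩ := hG.nonempty
  refine ⟨hasPole_of_directions h0 hδ ht hD o fun x => (hinf x o o).mono fun y hy => hy.1, ?_⟩
  obtain ⟨a, ha, haδ⟩ := exists_base_rpow_le_two h0
  have ha0 : 0 < a := by linarith
  obtain ⟨d, hd⟩ := exists_visualMetric (hX := hX) h0 hδ ha haδ (vertex hG o)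
  refine ⟨d, ⟨vertex hG o, a, 1 / 2, 1, ha, by norm_num, one_pos, fun ξ η => ?_⟩, ?_⟩
  · obtain ⟨h1, h2⟩ := hd ξ η
    exact ⟨by linarith, by linarith⟩
  -- `n` below is the least height with `n - t - 5 * δ ≥ τ`; then `n + t + 2 * δ ≤ τ + σ`. The
  -- factor `3` in `S` beats the `2` of the visual metric strictly.
  set σ : ℝ := 2 * t + 7 * δ + 1 with hσ
  refine ⟨3 * a ^ σ, ?_, 1, one_pos, fun ξ ε hε hε1 => ?_⟩
  · have : 1 ≤ a ^ σ := Real.one_le_rpow ha.le (by positivity)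
    linarith
  set τ : ℝ := -Real.logb a ε with hτ
  have hτ0 : 0 ≤ τ := by
    rw [hτ, neg_nonneg]; exact Real.logb_nonpos ha hε.le hε1
  have hετ : a ^ (-τ) = ε := by
    rw [hτ, neg_neg]; exact Real.rpow_logb ha0 ha.ne' hε
  set n : ℕ := ⌈τ + t + 5 * δ⌉₊ with hn
  have hn1 : τ + t + 5 * δ ≤ n := Nat.le_ceil _
  have hn2 : (n : ℝ) < τ + t + 5 * δ + 1 := Nat.ceil_lt_add_one (by positivity)
  obtain ⟨η, h1, h2⟩ := exists_boundaryProduct_between h0 hδ ht hD hinf o ξ n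
  obtain ⟨h3, h4⟩ := hd ξ η
  refine ⟨η, ?_, ?_⟩
  · have h5 : a ^ (-(τ + σ)) ≤ expNeg a (boundaryProduct (vertex hG o) ξ η) :=
      rpow_le_expNeg ha (by positivity) (h2.trans (ENNReal.ofReal_le_ofReal (by linarith)))
    have h6 : a ^ (-(τ + σ)) = ε / a ^ σ := by
      rw [neg_add, Real.rpow_add ha0, hετ, Real.rpow_neg ha0.le]; rfl
    have h7 : 0 < ε / a ^ σ := by positivity
    have h8 : ε / (3 * a ^ σ) = ε / a ^ σ / 3 := by rw [mul_comm, div_div]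
    rw [h8]
    change _ < d.dist ξ η
    linarith
  · refine h3.trans ((expNeg_le_rpow ha ((ENNReal.ofReal_le_ofReal ?_).trans h1)).trans hετ.le)
    linarith

end Forward

/-! ### Graphs with a pole and a uniformly perfect boundary -/

section Backward

open MetricGraph

/-- Uniform perfectness of a visual metric: there are boundary points at all prescribed Gromov
products from a given one. -/
theorem exists_boundaryProduct_of_isUniformlyPerfect {X : Type*} [MetricSpace X]
    {hX : IsGromovHyperbolic X} {d : MetricSpace (GromovBoundary X hX)} (hd : IsVisualMetric d)
    (hperf : @IsUniformlyPerfect (GromovBoundary X hX) d) :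
    ∃ (o : X) (τ₀ σ : ℝ), 0 ≤ τ₀ ∧ 0 ≤ σ ∧ ∀ (ξ : GromovBoundary X hX) (τ : ℝ), τ₀ ≤ τ →
      ∃ η, ENNReal.ofReal τ ≤ boundaryProduct o ξ η ∧
        boundaryProduct o ξ η ≤ ENNReal.ofReal (τ + σ) := by
  obtain ⟨o, a, c₁, c₂, ha, hc₁, hc₂, hd⟩ := hd
  obtain ⟨S, hS, ε₀, hε₀, hperf⟩ := hperf
  have ha0 : 0 < a := by linarith
  refine ⟨o, max 0 (-Real.logb a (ε₀ / c₁)), max 0 (Real.logb a (S * c₂ / c₁)), le_max_left _ _,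
    le_max_left _ _, fun ξ τ hτ => ?_⟩
  have hτ0 : 0 ≤ τ := (le_max_left _ _).trans hτ
  have hε : c₁ * a ^ (-τ) ≤ ε₀ := by
    have h1 : -τ ≤ Real.logb a (ε₀ / c₁) := by linarith [(le_max_right _ _).trans hτ]
    rw [Real.le_logb_iff_rpow_le ha (by positivity), le_div_iff₀ hc₁] at h1
    linarith
  -- At this scale the upper bound on the distance reads `(ξ|η)_o ≥ τ`, and the lower one bounds
  -- `(ξ|η)_o - τ` by the logarithm of `S * c₂ / c₁`.
  obtain ⟨η, h1, h2⟩ := hperf ξ (c₁ * a ^ (-τ)) (by positivity) hε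
  obtain ⟨h3, h4⟩ := hd ξ η
  have h5 : expNeg a (boundaryProduct o ξ η) ≤ a ^ (-τ) :=
    le_of_mul_le_mul_left (h3.trans h2) hc₁
  have h6 : c₁ * a ^ (-τ) / S < c₂ * expNeg a (boundaryProduct o ξ η) := h1.trans_le h4
  have hfin : boundaryProduct o ξ η ≠ ∞ := by
    intro h
    rw [h, expNeg_top, mul_zero] at h6
    exact absurd h6 (not_lt.2 (by positivity))
  rw [expNeg_of_ne_top a hfin] at h5 h6
  refine ⟨η, ?_, ?_⟩
  · rw [Real.rpow_le_rpow_left_iff ha] at h5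
    exact (ENNReal.ofReal_le_iff_le_toReal hfin).2 (by linarith)
  · rw [ENNReal.le_ofReal_iff_toReal_le hfin (by positivity)]
    rw [div_lt_iff₀ (by linarith)] at h6
    have h7 : a ^ ((boundaryProduct o ξ η).toReal - τ) ≤ S * c₂ / c₁ := by
      rw [le_div_iff₀ hc₁, sub_eq_add_neg, Real.rpow_add ha0]
      rw [Real.rpow_neg ha0.le (boundaryProduct o ξ η).toReal] at h6
      set r := a ^ (boundaryProduct o ξ η).toReal
      have hr : 0 < r := by positivity
      calc r * a ^ (-τ) * c₁ = r * (c₁ * a ^ (-τ)) := by ring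
        _ ≤ r * (c₂ * r⁻¹ * S) := mul_le_mul_of_nonneg_left h6.le hr.le
        _ = S * c₂ := by field_simp
    have h8 := (Real.le_logb_iff_rpow_le ha (by positivity)).2 h7
    linarith [le_max_right 0 (Real.logb a (S * c₂ / c₁))]

/-- The same in terms of sequences, with respect to any base point. -/
theorem exists_sequence_of_isUniformlyPerfect {X : Type*} [MetricSpace X]
    {hX : IsGromovHyperbolic X} {δ : ℝ} (h0 : 0 ≤ δ) (hδ : DeltaInequality X δ)
    {d : MetricSpace (GromovBoundary X hX)} (hd : IsVisualMetric d)
    (hperf : @IsUniformlyPerfect (GromovBoundary X hX) d) (o : X) :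
    ∃ τ₀ σ : ℝ, 0 ≤ τ₀ ∧ 0 ≤ σ ∧ ∀ x : ℕ → X, ConvergesToInfinity x → ∀ τ : ℝ, τ₀ ≤ τ →
      ∃ y : ℕ → X, ConvergesToInfinity y ∧ ∃ N, ∀ i j, N ≤ i → N ≤ j →
        τ ≤ gromovProduct o (x i) (y j) ∧ gromovProduct o (x i) (y j) ≤ τ + σ := by
  obtain ⟨o', τ₀, σ, hτ₀, hσ, H⟩ := exists_boundaryProduct_of_isUniformlyPerfect hd hperf
  have hoo : 0 ≤ dist o o' := dist_nonneg
  refine ⟨τ₀, 2 * dist o o' + σ + 3 * δ + 2, hτ₀, by positivity, fun x hx τ hτ => ?_⟩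
  set ξ : GromovBoundary X hX := Quotient.mk _ ⟨x, hx⟩
  -- The shift pays in advance for the change of base point, the passage to sequences and a strict
  -- inequality.
  obtain ⟨η, h1, h2⟩ := H ξ (τ + dist o o' + δ + 1) (by linarith)
  obtain ⟨y, rfl⟩ := Quotient.exists_rep η
  obtain ⟨N₁, hN₁⟩ := exists_forall_ge_of_lt_boundaryProduct hδ (t := τ + dist o o' + δ)
    (lt_of_lt_of_le ((ENNReal.ofReal_lt_ofReal_iff (by linarith)).2 (by linarith)) h1)
  obtain ⟨N₂, hN₂⟩ := exists_forall_le_of_boundaryProduct_lt h0 hδ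
    (t := τ + dist o o' + δ + 1 + σ + 1)
    (lt_of_le_of_lt h2 ((ENNReal.ofReal_lt_ofReal_iff (by linarith)).2 (by linarith)))
  refine ⟨y.1, y.2, max N₁ N₂, fun i j hi hj => ?_⟩
  have h3 := hN₁ i j ((le_max_left _ _).trans hi) ((le_max_left _ _).trans hj)
  have h4 := hN₂ i j ((le_max_right _ _).trans hi) ((le_max_right _ _).trans hj)
  have h5 := gromovProduct_le_add_dist_base o o' (x i) (y.1 j)
  have h6 := gromovProduct_le_add_dist_base o' o (x i) (y.1 j)
  rw [dist_comm o' o] at h6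
  simp only at h3 h4
  constructor <;> linarith

/-- A pole, in terms of sequences. -/
theorem HasPole.exists_sequence {X : Type*} [MetricSpace X] (h : HasPole X) (o : X) :
    ∃ M : ℝ, 0 ≤ M ∧ ∀ x : X, ∃ y : ℕ → X, ConvergesToInfinity y ∧
      ∃ N, ∀ n, N ≤ n → dist x o - M ≤ gromovProduct o x (y n) := by
  obtain ⟨v, M, hM, h⟩ := h
  -- Replacing `x` by `γ t` and `v` by `o` is paid for twice: in the product and in the comparison
  -- of `t` with `dist x o`.
  refine ⟨2 * M + 2 * dist o v, by positivity, fun x => ?_⟩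
  obtain ⟨γ, hγ, hγ0, t, ht⟩ := h x
  have hprod : ∀ s u : ℝ≥0, s ≤ u → gromovProduct v (γ s) (γ u) = s := by
    intro s u hsu
    have hsu' : (s : ℝ) ≤ u := hsu
    rw [gromovProduct, ← hγ0, hγ.dist_eq, hγ.dist_eq, hγ.dist_eq, NNReal.dist_eq, NNReal.dist_eq,
      NNReal.dist_eq, abs_sub_comm (s : ℝ) u, abs_of_nonneg (sub_nonneg.2 hsu')]
    simp only [NNReal.coe_zero, sub_zero, NNReal.abs_eq]
    ring
  refine ⟨fun n => γ n, ?_, ⌈t⌉₊, fun n hn => ?_⟩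
  · refine ConvergesToInfinity.of_eventually_ge v fun b => ?_
    obtain ⟨N, hN⟩ := exists_nat_ge b
    refine ⟨N, fun i j hi hj => ?_⟩
    rcases le_total i j with hij | hij
    · rw [hprod _ _ (by exact_mod_cast hij)]
      exact hN.trans (by simpa using hi)
    · rw [gromovProduct_comm, hprod _ _ (by exact_mod_cast hij)]
      exact hN.trans (by simpa using hj)
  · have h1 := hprod t n (Nat.ceil_le.1 hn)
    have h2 := gromovProduct_le_add_dist_left v (γ t) (γ n) x
    have h3 := gromovProduct_le_add_dist_base v o x (γ n)
    have h4 : dist v (γ t) = t := by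
      rw [← hγ0, hγ.dist_eq, NNReal.dist_eq]; simp
    have h5 := dist_triangle x (γ t) o
    have h6 := dist_triangle (γ t) v o
    rw [dist_comm (γ t) v] at h6
    rw [dist_comm (γ t) x] at h2
    rw [dist_comm v o] at h3 h6
    linarith

variable {V : Type*} {G : SimpleGraph V} {hG : G.Connected}

/-- Many vertices in the shadow of a given vertex, at the same distance from the base point. -/
theorem exists_many_descendants {δ τ₀ σ M : ℝ} (h0 : 0 ≤ δ)
    (hδ : DeltaInequality (MetricGraph G hG) δ) (hτ₀ : 0 ≤ τ₀) (hσ : 0 ≤ σ) (hM : 0 ≤ M) (o : V)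
    (hpole : ∀ x : MetricGraph G hG, ∃ y : ℕ → MetricGraph G hG, ConvergesToInfinity y ∧
      ∃ N, ∀ n, N ≤ n → dist x (vertex hG o) - M ≤ gromovProduct (vertex hG o) x (y n))
    (hperf : ∀ x : ℕ → MetricGraph G hG, ConvergesToInfinity x → ∀ τ : ℝ, τ₀ ≤ τ →
      ∃ y : ℕ → MetricGraph G hG, ConvergesToInfinity y ∧ ∃ N, ∀ i j, N ≤ i → N ≤ j →
        τ ≤ gromovProduct (vertex hG o) (x i) (y j) ∧
          gromovProduct (vertex hG o) (x i) (y j) ≤ τ + σ) (m : ℕ) :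
    ∃ R : ℕ, ∀ x : V, ∃ y : Fin m → V, Function.Injective y ∧ ∀ j,
      G.dist o (y j) = G.dist o x + R ∧
        (G.dist o x : ℝ) - M - 2 * δ - 1 ≤
          gromovProduct (vertex hG o) (vertex hG x) (vertex hG (y j)) := by
  set O := vertex hG o
  obtain ⟨R, hR⟩ := exists_nat_ge (τ₀ + (m + 1) * (σ + δ + 1) + 2 * δ + 2)
  refine ⟨R, fun x => ?_⟩
  obtain ⟨w, hw, N₀, hN₀⟩ := hpole (vertex hG x)
  rw [dist_vertex, G.dist_comm] at hN₀
  have hτ : ∀ j : Fin m, τ₀ ≤ G.dist o x + τ₀ + j * (σ + δ + 1) := fun j => by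
    have : (0 : ℝ) ≤ j * (σ + δ + 1) := by positivity
    have : (0 : ℝ) ≤ G.dist o x := Nat.cast_nonneg _
    linarith
  -- Heights spaced by `σ + δ + 1` exceed the window `σ` by more than `δ`, so different `u j` must
  -- separate from each other; `R` lies beyond all these heights.
  choose u hu N₁ hN₁ using fun j : Fin m => hperf w hw _ (hτ j)
  have hfar : ∀ j : Fin m, ∃ N, ∀ n, N ≤ n → (G.dist o x : ℝ) + R + 1 ≤ dist (u j n) O := by
    intro j
    obtain ⟨N, hN⟩ := (hu j).eventually_ge O (G.dist o x + R + 1)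
    exact ⟨N, fun n hn => (hN n n hn hn).trans (gromovProduct_le_dist _ _ _)⟩
  choose N₂ hN₂ using hfar
  set n := N₀ + ∑ j, (N₁ j + N₂ j) with hn
  have hn0 : N₀ ≤ n := Nat.le_add_right _ _
  have hn12 : ∀ j, N₁ j ≤ n ∧ N₂ j ≤ n := by
    intro j
    have := Finset.single_le_sum (f := fun j => N₁ j + N₂ j) (fun _ _ => Nat.zero_le _)
      (Finset.mem_univ j)
    omega
  choose z hz using fun j => exists_dist_vertex_le (u j n)
  have hoz : ∀ j, G.dist o x + R ≤ G.dist o (z j) := by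
    intro j
    have h1 := hN₂ j n (hn12 j).2
    have h2 := dist_triangle (u j n) (vertex hG (z j)) O
    rw [dist_vertex, G.dist_comm] at h2
    have : ((G.dist o x + R : ℕ) : ℝ) ≤ G.dist o (z j) := by push_cast; linarith [hz j]
    exact_mod_cast this
  choose y hy1 hy2 using fun j => hG.exists_dist_eq o (z j) (hoz j)
  have hyz : ∀ j, gromovProduct O (vertex hG (y j)) (vertex hG (z j)) = G.dist o x + R := by
    intro j
    rw [gromovProduct_vertex_of_between (by rw [hy1, hy2]), hy1]; push_cast; rfl
  have hwz : ∀ j : Fin m, G.dist o x + τ₀ + j * (σ + δ + 1) - 1 ≤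
        gromovProduct O (w n) (vertex hG (z j)) ∧
      gromovProduct O (w n) (vertex hG (z j)) ≤ G.dist o x + τ₀ + j * (σ + δ + 1) + σ + 1 := by
    intro j
    obtain ⟨h1, h2⟩ := hN₁ j n n (hn12 j).1 (hn12 j).1
    have h3 := gromovProduct_le_add_dist_right O (w n) (u j n) (vertex hG (z j))
    have h4 := gromovProduct_le_add_dist_right O (w n) (vertex hG (z j)) (u j n)
    rw [dist_comm (vertex hG (z j))] at h4
    have := hz j
    constructor <;> linarith
  have hwu : ∀ j : Fin m, G.dist o x + τ₀ + j * (σ + δ + 1) ≤ gromovProduct O (w n) (u j n) ∧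
      gromovProduct O (w n) (u j n) ≤ G.dist o x + τ₀ + j * (σ + δ + 1) + σ := fun j =>
    hN₁ j n n (hn12 j).1 (hn12 j).1
  refine ⟨y, ?_, fun j => ⟨hy1 j, ?_⟩⟩
  -- A common cut point would make `(u j|u i)_o` at least the height of `u j`, and the
  -- `δ`-inequality would lift `(w|u i)_o` above its window.
  · have key : ∀ i j : Fin m, i < j → y i ≠ y j := by
      intro i j hij heq
      have h1 : (G.dist o x : ℝ) + R - δ ≤ gromovProduct O (vertex hG (z j)) (vertex hG (z i)) := by
        refine hδ.le_gromovProduct (z := vertex hG (y j)) ?_ ?_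
        · rw [gromovProduct_comm, hyz]
        · rw [← heq, hyz]
      have h2 := gromovProduct_le_add_dist_left O (vertex hG (z j)) (vertex hG (z i)) (u j n)
      have h3 := gromovProduct_le_add_dist_right O (u j n) (vertex hG (z i)) (u i n)
      rw [dist_comm (vertex hG (z j))] at h2
      rw [dist_comm (vertex hG (z i))] at h3
      have hij' : (i : ℝ) + 1 ≤ j := by exact_mod_cast hij
      have hjm : (j : ℝ) ≤ m := by exact_mod_cast j.2.le
      have hpos : 0 < σ + δ + 1 := by positivity
      have h5 : ((i : ℝ) + 1) * (σ + δ + 1) ≤ j * (σ + δ + 1) :=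
        mul_le_mul_of_nonneg_right hij' hpos.le
      have h6 : (j : ℝ) * (σ + δ + 1) ≤ m * (σ + δ + 1) := mul_le_mul_of_nonneg_right hjm hpos.le
      have h8 := hδ.le_gromovProduct (o := O) (x := w n) (y := u i n) (z := u j n)
        (t := G.dist o x + τ₀ + j * (σ + δ + 1)) (hwu j).1
        (by linarith [hz i, hz j])
      linarith [(hwu i).2]
    intro i j hij
    rcases lt_trichotomy i j with h | h | h
    · exact absurd hij (key i j h)
    · exact h
    · exact absurd hij.symm (key j i h)
  · have hx := hN₀ n hn0
    have h1 : (0 : ℝ) ≤ j * (σ + δ + 1) := by positivity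
    have h2 := hδ.le_gromovProduct (o := O) (x := vertex hG x) (y := vertex hG (z j)) (z := w n)
      (t := G.dist o x - M - 1) (by linarith) (by linarith [(hwz j).1])
    have hR0 : (0 : ℝ) ≤ R := Nat.cast_nonneg R
    have h3 := hδ.le_gromovProduct (o := O) (x := vertex hG x) (y := vertex hG (y j))
      (z := vertex hG (z j)) (t := G.dist o x - M - 1 - δ) (by linarith)
      (by rw [gromovProduct_comm, hyz]; linarith)
    linarith

/-- If a map with bounded displacement has many preimages near every vertex, then the graph
satisfies an isoperimetric inequality. -/
theorem exists_isoperimetry_of_preimages (hG : G.Connected) {D : ℕ} (hD : HasDegreeBound G D)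
    (c R : ℕ) (φ : V → V) (hφ : ∀ y, G.dist y (φ y) ≤ R)
    (hmany : ∀ x : V, ∃ y : Fin (2 * D ^ c) → V, Function.Injective y ∧
      ∀ j, G.dist x (φ (y j)) ≤ c) :
    ∃ h : ℝ, 0 < h ∧ HasIsoperimetry G h := by
  classical
  have hD0 : (0 : ℝ) < D := by exact_mod_cast (by have := hD.1; omega : 0 < D)
  refine ⟨1 / (D : ℝ) ^ (c + R), by positivity, fun A => ?_⟩
  have hball := fun (v : V) n => hG.distBall_finite_ncard_le hD.2 v n
  -- the neighbourhood of `A`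
  set U : Finset V := A.biUnion fun v => (hball v (c + R)).1.toFinset with hU
  have mem_U : ∀ y, y ∈ U ↔ ∃ v ∈ A, G.dist v y ≤ c + R := by
    intro y; simp [hU, SimpleGraph.mem_distBall]
  have hAU : A ⊆ U := fun v hv => (mem_U v).2 ⟨v, hv, by simp⟩
  -- double counting
  have hdouble : 2 * A.card ≤ U.card := by
    -- Pairs with `d(x, φ y) ≤ c`: each `x` in `A` has at least `2 * D ^ c` partners, all in `U`,
    -- and each `y` has at most as many as a ball of radius `c` around `φ y` contains.
    have h1 : A.card * (2 * D ^ c) ≤ U.card * D ^ c := by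
      refine Finset.card_mul_le_card_mul (fun x y => G.dist x (φ y) ≤ c) (fun x hx => ?_)
        (fun y hy => ?_)
      · obtain ⟨y, hinj, hy⟩ := hmany x
        calc 2 * D ^ c = (Finset.univ.image y).card := by
              rw [Finset.card_image_of_injective _ hinj, Finset.card_univ, Fintype.card_fin]
          _ ≤ _ := by
              refine Finset.card_le_card fun z hz => ?_
              obtain ⟨j, -, rfl⟩ := Finset.mem_image.1 hz
              rw [Finset.mem_bipartiteAbove]
              refine ⟨(mem_U _).2 ⟨x, hx, ?_⟩, hy j⟩
              have h2 : G.dist x (y j) ≤ G.dist x (φ (y j)) + G.dist (φ (y j)) (y j) :=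
                hG.dist_triangle
              have h3 := hφ (y j)
              rw [G.dist_comm] at h3
              have h4 := hy j
              omega
      · calc (Finset.bipartiteBelow (fun x y => G.dist x (φ y) ≤ c) A y).card
            ≤ (hball (φ y) c).1.toFinset.card := by
              refine Finset.card_le_card fun x hx => ?_
              rw [Finset.mem_bipartiteBelow] at hx
              rw [Finite.mem_toFinset, SimpleGraph.mem_distBall, G.dist_comm]
              exact hx.2
          _ ≤ D ^ c := by
              rw [← ncard_eq_toFinset_card _ (hball (φ y) c).1]; exact (hball _ _).2
    have h2 : 0 < D ^ c := by have := hD.1; positivity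
    refine Nat.le_of_mul_le_mul_right ?_ h2
    linarith
  -- the neighbourhood is covered by balls around the boundary
  have hbd := hD.finite_vertexBoundary A
  have hcover : U \ A ⊆ hbd.toFinset.biUnion fun v => (hball v (c + R)).1.toFinset := by
    intro y hy
    obtain ⟨hyU, hyA⟩ := Finset.mem_sdiff.1 hy
    obtain ⟨v, hv, hvy⟩ := (mem_U y).1 hyU
    -- The first vertex outside `A` on a geodesic from `v` to `y` is a boundary vertex no farther
    -- from `y`.
    have hex : ∀ (n : ℕ) (v : V), v ∈ A → G.dist v y = n →
        ∃ b ∈ vertexBoundary G (A : Set V), G.dist b y ≤ n := by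
      intro n
      induction n with
      | zero =>
        intro v hv h
        exact absurd (hG.dist_eq_zero_iff.1 h ▸ hv) hyA
      | succ n ih =>
        intro v hv h
        obtain ⟨w, h1, h2⟩ := hG.exists_dist_eq v y (n := 1) (by omega)
        by_cases hw : w ∈ A
        · obtain ⟨b, hb, hb'⟩ := ih w hw (by omega)
          exact ⟨b, hb, by omega⟩
        · exact ⟨w, mem_vertexBoundary.2
            ⟨hw, v, hv, (SimpleGraph.dist_eq_one_iff_adj.1 h1).symm⟩, by omega⟩
    obtain ⟨b, hb, hby⟩ := hex _ v hv rfl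
    refine Finset.mem_biUnion.2 ⟨b, hbd.mem_toFinset.2 hb, ?_⟩
    rw [Finite.mem_toFinset, SimpleGraph.mem_distBall]
    omega
  have h1 := (Finset.card_le_card hcover).trans (Finset.card_biUnion_le_card_mul _ _
    (D ^ (c + R)) fun v _ => by
      rw [← ncard_eq_toFinset_card _ (hball v (c + R)).1]; exact (hball _ _).2)
  rw [Finset.card_sdiff_of_subset hAU, ← ncard_eq_toFinset_card _ hbd] at h1
  have h2 : A.card ≤ (vertexBoundary G (A : Set V)).ncard * D ^ (c + R) := by omega
  have h3 : (A.card : ℝ) ≤ (vertexBoundary G (A : Set V)).ncard * (D : ℝ) ^ (c + R) := by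
    exact_mod_cast h2
  rw [one_div_mul_eq_div, div_le_iff₀ (by positivity)]
  exact h3

/-- A pole and a uniformly perfect boundary yield a positive Cheeger constant. -/
theorem exists_isoperimetry_of_isUniformlyPerfect (hX : IsGromovHyperbolic (MetricGraph G hG))
    {D : ℕ} (hD : HasDegreeBound G D) (hpole : HasPole (MetricGraph G hG))
    {d : MetricSpace (GromovBoundary (MetricGraph G hG) hX)} (hd : IsVisualMetric d)
    (hperf : @IsUniformlyPerfect (GromovBoundary (MetricGraph G hG) hX) d) :
    ∃ h : ℝ, 0 < h ∧ HasIsoperimetry G h := by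
  obtain ⟨δ, h0, hδ⟩ := id hX
  replace hδ : DeltaInequality (MetricGraph G hG) δ := hδ
  obtain ⟨o⟩ := hG.nonempty
  obtain ⟨M, hM, hpole⟩ := hpole.exists_sequence (vertex hG o)
  obtain ⟨τ₀, σ, hτ₀, hσ, hperf⟩ :=
    exists_sequence_of_isUniformlyPerfect h0 hδ hd hperf (vertex hG o)
  obtain ⟨c, hc⟩ := exists_nat_ge (2 * (M + 3 * δ + 1))
  -- The distance bound `c` is independent of the number of descendants, which only affects `R`; so
  -- `2 * D ^ c` of them may be requested.
  obtain ⟨R, hR⟩ := exists_many_descendants h0 hδ hτ₀ hσ hM o hpole hperf (2 * D ^ c)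
  -- `φ` moves `R` steps towards `o`; by truncated subtraction it stops at `o` for nearer vertices.
  choose φ hφ1 hφ2 using fun y => hG.exists_dist_eq o y (Nat.sub_le (G.dist o y) R)
  refine exists_isoperimetry_of_preimages hG hD c R φ (fun y => ?_) fun x => ?_
  · have := hφ2 y
    rw [G.dist_comm]; omega
  · obtain ⟨y, hinj, hy⟩ := hR x
    refine ⟨y, hinj, fun j => ?_⟩
    obtain ⟨h1, h2⟩ := hy j
    have h3 : G.dist o (φ (y j)) = G.dist o x := by rw [hφ1, h1]; omega
    have h4 : gromovProduct (vertex hG o) (vertex hG (φ (y j))) (vertex hG (y j)) =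
        G.dist o x := by
      rw [gromovProduct_vertex_of_between (by have := hφ2 (y j); omega), h3]
    have h5 := hδ.le_gromovProduct h2 (y := vertex hG (φ (y j)))
      (by rw [gromovProduct_comm, h4]; linarith)
    rw [gromovProduct_vertex, h3] at h5
    have : (G.dist x (φ (y j)) : ℝ) ≤ c := by linarith
    exact_mod_cast this

end Backward

theorem mainTheorem3 {V : Type*} (G : SimpleGraph V) (hG : G.Connected)
    (hunif : IsUniformGraph G) (hhyp : IsGromovHyperbolic (MetricGraph G hG)) :
    0 < cheegerConstant G ↔
      Infinite V ∧ HasPole (MetricGraph G hG) ∧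
        ∃ d : MetricSpace (GromovBoundary (MetricGraph G hG) hhyp),
          IsVisualMetric d ∧
            @IsUniformlyPerfect (GromovBoundary (MetricGraph G hG) hhyp) d := by
  obtain ⟨D, hD⟩ := hunif.exists_hasDegreeBound
  rw [cheegerConstant_pos_iff hD]
  constructor
  · rintro ⟨h, hh, hiso⟩
    have := hG.nonempty
    exact ⟨hiso.infinite hh, hasPole_and_isUniformlyPerfect hhyp hD hh hiso⟩
  · rintro ⟨-, hpole, d, hd, hperf⟩
    exact exists_isoperimetry_of_isUniformlyPerfect hhyp hD hpole hd hperf
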